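/- **Setting.** Let $d\in\mathbb N_0$ and let $\Psi:\mathbb C^d\to\mathbb C$ be a function (the symbol) with $\Psi(0)=0$ such that - (P1) $\Psi$ is analytic in a neighbourhood of $0$; - (P2) there is $c\in\mathbb R$ with $\operatorname{Re}\Psi(-i\xi)\le c\log(1+\|\xi\|)$ for all $\xi\in\mathbb R^d$; - (P3) $\xi\mapsto\Psi(-i\xi)$ is $C^\infty$ on $\mathbb R^d$, and each of its partial derivatives $D_\alpha$ satisfies $|D_\alpha\Psi(-i\xi)|\le b_\alpha(1+\|\xi\|)^{N_\alpha}$ for all $\xi\in\mathbb R^d$. For $n\ge 1$ put $C^{(n)}_{X_1\cdots X_n}=\dfrac{\partial^n\Psi}{\partial\xi_{X_1}\cdots\partial\xi_{X_n}}(0)$, $X_1,\dots,X_n\in\{1,\dots,d\}$. With $\mathcal F g(\xi)=\int_{\mathbb R^d} g(x)e^{i\langle\xi,x\rangle}dx$, let $\Psi(\nabla)$ be the operator given by $\mathcal F(\Psi(\nabla)g)(\xi)=\Psi(-i\xi)\,\mathcal F g(\xi)$. Let $\bar p\ge 2$ be even, let $\lambda^{(p)}$ ($0\le p\le\bar p$)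 be real tensors of degree $p$ over $\mathbb R^d$ with components $\lambda^{(p)}_{X_1\cdots X_p}$, and let $$V(\phi)=\sum_{p=0}^{\bar p}\ \sum_{X_1,\dots,X_p=1}^d\lambda^{(p)}_{X_1\cdots X_p}\phi_{X_1}\cdots\phi_{X_p},$$ where the part of degree $\bar p$ is $>0$ for every $\phi\ne 0$. For $\beta>0$ put $f_\beta=e^{-\beta V}$, and consider the Cauchy problem $$\partial_t\Phi_t=\Psi(\nabla)\Phi_t\quad(t>0),\qquad \Phi_0=f_\beta, \tag{1}$$ where a solution is a family $(\Phi_t)_{t\ge 0}$ of Schwartz functions, differentiable in $t>0$ and right-continuous at $t=0$ in the topology of $\mathcal S(\mathbb R^d)$. **Feynman graphs.** A *generalized amputated Feynman graph* with $m$ inner full vertices having $p_1,\dots,p_m$ legs is a graph with inner full, inner empty and outer empty vertices, in which every edge connects a leg of a full vertex with an empty vertex, every leg of a full vertex is the end of exactly one edge, every outer empty vertex is met by exactly one edge, and every inner empty vertex is met by at least one edge. Full vertices and their legs are distinguishable; the inner empty vertices are non-distinguishable among themselves, and so are the outer empty vertices. $\bar F(m)$ is the (finite) set of such graphs with $m$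 inner full vertices for which $p_j\le\bar p$ and $\lambda^{(p_j)}\ne0$ for $j=1,\dots,m$. The value $\mathcal V[G](t,\phi)$ of $G\in\bar F(m)$ is obtained as follows: assign to each leg $a$ of a full vertex a value $X_a\in\{1,\dots,d\}$; take a factor $\lambda^{(p_j)}_{X_{(1,j)}\cdots X_{(p_j,j)}}$ for the $j$-th full vertex, where $(1,j),\dots,(p_j,j)$ are its legs; a factor $\phi_{X_b}$ for each outer empty vertex, where $b$ is the leg connected with it; a factor $t\,C^{(l)}_{X_{a_1}\cdots X_{a_l}}$ for each inner empty vertex, where $a_1,\dots,a_l$ are the legs connected with it; multiply these factors and sum over all assignments $X$. **Theorem 2.11.** For every $\beta>0$ the Cauchy problem (1) has a unique solution $\Phi^\beta_t$. It is $\Phi^\beta_t=\nu_t*f_\beta$, where $\nu_t\in\mathcal S'(\mathbb R^d)$ is the inverse Fourier transform of $\xi\mapsto e^{t\Psi(-i\xi)}$. The solution $\Phi_t=\Phi_t^1$ of the Cauchy problem with datum $f=e^{-V}$ has the asymptotic expansion in powers of $V$ $$\Phi_t(\phi)=\sum_{m=0}^\infty\frac{(-1)^m}{m!}\sum_{G\in\bar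 F(m)}\mathcal V[G](t,\phi),$$ that is, for all $t>0$, $\phi\in\mathbb R^d$ and $N\in\mathbb N_0$, $$\lim_{\beta\searrow0}\beta^{-N}\Bigl|\Phi_t^\beta(\phi)-\sum_{m=0}^N\beta^m\,\frac{(-1)^m}{m!}\sum_{G\in\bar F(m)}\mathcal V[G](t,\phi)\Bigr|=0.$$ -/

import Mathlib

open MeasureTheory Filter Topology
open scoped SchwartzMap BigOperators

noncomputable section

namespace FeynmanExpansion

/-- The space of positions `φ` and of (real) frequencies `ξ`. -/
abbrev Space (d : ℕ) : Type := EuclideanSpace ℝ (Fin d)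

/-! ### The symbol -/

/-- The function `ξ ↦ Ψ(-iξ)` of a real frequency `ξ`. -/
def axisSymbol {d : ℕ} (Ψ : (Fin d → ℂ) → ℂ) (ξ : Space d) : ℂ :=
  Ψ (fun j => -Complex.I * (ξ j : ℂ))

/-- The requirements on the symbol: `Ψ` is analytic at the origin, `Re Ψ(-iξ)` grows at most
logarithmically, all derivatives of `ξ ↦ Ψ(-iξ)` exist and are polynomially bounded, and
`Ψ(0) = 0`. -/
structure IsAdmissibleSymbol {d : ℕ} (Ψ : (Fin d → ℂ) → ℂ) : Prop where
  analytic : AnalyticAt ℂ Ψ 0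
  re_le_log : ∃ c : ℝ, ∀ ξ : Space d, (axisSymbol Ψ ξ).re ≤ c * Real.log (1 + ‖ξ‖)
  smooth : ContDiff ℝ (⊤ : ℕ∞) (axisSymbol Ψ)
  deriv_bound : ∀ n : ℕ, ∃ (N : ℕ) (b : ℝ), ∀ ξ : Space d,
    ‖iteratedFDeriv ℝ n (axisSymbol Ψ) ξ‖ ≤ b * (1 + ‖ξ‖) ^ N
  map_zero : Ψ 0 = 0

/-- The coefficient `C^{(n)}_{X₁ … Xₙ}`: the partial derivative of `Ψ` at the origin with respect
to the coordinates `X₁, …, Xₙ`. -/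
def symbolCoeff {d : ℕ} (Ψ : (Fin d → ℂ) → ℂ) (n : ℕ) (X : Fin n → Fin d) : ℂ :=
  iteratedFDeriv ℂ n Ψ 0 (fun k => Pi.single (X k) 1)

/-! ### The Cauchy problem -/

/-- The Fourier transform `ℱ g (ξ) = ∫ g(x) e^{i⟨ξ,x⟩} dx`. -/
def fourier {d : ℕ} (g : Space d → ℂ) (ξ : Space d) : ℂ :=
  ∫ x : Space d, g x * Complex.exp (Complex.I * (inner ℝ ξ x : ℝ))

/-- The inverse Fourier transform `ℱ⁻¹ g (x) = (2π)^{-d} ∫ g(ξ) e^{-i⟨ξ,x⟩} dξ`. -/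
def fourierInv {d : ℕ} (g : Space d → ℂ) (x : Space d) : ℂ :=
  ((2 * Real.pi : ℝ) : ℂ)⁻¹ ^ d *
    ∫ ξ : Space d, g ξ * Complex.exp (-Complex.I * (inner ℝ ξ x : ℝ))

/-- The pseudo-differential operator `Ψ(∇)`: since `ℱ(∂_X g)(ξ) = -i ξ_X ℱ g(ξ)`, it is
multiplication by `Ψ(-iξ)` on the Fourier side. -/
def pseudoDiff {d : ℕ} (Ψ : (Fin d → ℂ) → ℂ) (g : Space d → ℂ) : Space d → ℂ :=
  fourierInv (fun ξ => axisSymbol Ψ ξ * fourier g ξ)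

/-- `u` solves `∂ₜ u = Ψ(∇) u` on `(0, ∞)` with `u 0 = f`: `t ↦ u t` is a curve of Schwartz
functions, differentiable for `t > 0` and right-continuous at `0` in the Schwartz topology.
The values of `u` at negative times are irrelevant. -/
def IsCauchySolution {d : ℕ} (Ψ : (Fin d → ℂ) → ℂ) (f : Space d → ℂ)
    (u : ℝ → Space d → ℂ) : Prop :=
  ∃ U : ℝ → 𝓢(Space d, ℂ),
    (∀ t : ℝ, 0 ≤ t → ∀ φ, U t φ = u t φ) ∧
    u 0 = f ∧
    Tendsto U (𝓝[>] 0) (𝓝 (U 0)) ∧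
    ∀ t : ℝ, 0 < t → ∃ U' : 𝓢(Space d, ℂ),
      (∀ φ, U' φ = pseudoDiff Ψ (u t) φ) ∧
      Tendsto (fun s : ℝ => (s - t)⁻¹ • (U s - U t)) (𝓝[≠] t) (𝓝 U')

/-- The pairing `⟨νₜ, g⟩` of a test function `g` with the tempered distribution `νₜ`, the inverse
Fourier transform of `ξ ↦ e^{tΨ(-iξ)}`. -/
def nuPairing {d : ℕ} (Ψ : (Fin d → ℂ) → ℂ) (t : ℝ) (g : Space d → ℂ) : ℂ :=
  ∫ ξ : Space d, Complex.exp ((t : ℂ) * axisSymbol Ψ ξ) * fourierInv g ξ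

/-- The convolution `(νₜ * f)(φ) = ⟨νₜ, f(φ - ·)⟩`. -/
def nuConv {d : ℕ} (Ψ : (Fin d → ℂ) → ℂ) (t : ℝ) (f : Space d → ℂ) (φ : Space d) : ℂ :=
  nuPairing Ψ t (fun x => f (φ - x))

/-! ### The initial datum -/

/-- `⟨T, φ^{⊗p}⟩_p` for a real tensor `T` of degree `p`, given by its components. -/
def tensorForm {d p : ℕ} (T : (Fin p → Fin d) → ℝ) (φ : Space d) : ℝ :=
  ∑ X : Fin p → Fin d, T X * ∏ j, φ (X j)

/-- The polynomial `V(φ) = ∑_{p ≤ pbar} ⟨λ^{(p)}, φ^{⊗p}⟩_p`. -/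
def potential {d : ℕ} (pbar : ℕ) (lam : (p : ℕ) → (Fin p → Fin d) → ℝ) (φ : Space d) : ℝ :=
  ∑ p ∈ Finset.range (pbar + 1), tensorForm (lam p) φ

/-- The initial datum `f_β = e^{-βV}`. -/
def initialDatum {d : ℕ} (pbar : ℕ) (lam : (p : ℕ) → (Fin p → Fin d) → ℝ) (β : ℝ)
    (φ : Space d) : ℂ :=
  ((Real.exp (-β * potential pbar lam φ) : ℝ) : ℂ)

/-! ### Generalized amputated Feynman graphs -/

/-- The legs of `m` inner full vertices with `p 0, …, p (m - 1)` legs. The leg `⟨j, l⟩` belongs to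
the `j`-th inner full vertex. -/
abbrev Leg {m : ℕ} (p : Fin m → ℕ) : Type := Σ j : Fin m, Fin (p j)

/-- Endpoints of edges: the (distinguishable) legs of the inner full vertices, `k` inner empty
vertices and `q` outer empty vertices. -/
abbrev Endpoint {m : ℕ} (p : Fin m → ℕ) (k q : ℕ) : Type := Leg p ⊕ (Fin k ⊕ Fin q)

/-- A generalized amputated Feynman graph with inner full vertices with `p 0, …, p (m - 1)`
legs, whose inner and outer empty vertices still carry (arbitrary) labels. -/
structure LabelledGraph {m : ℕ} (p : Fin m → ℕ) where
  /-- the number of inner empty vertices -/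
  k : ℕ
  /-- the number of outer empty vertices -/
  q : ℕ
  /-- the edges -/
  graph : SimpleGraph (Endpoint p k q)
  /-- no edge connects two full vertices -/
  not_full_full : ∀ a b : Leg p, ¬ graph.Adj (Sum.inl a) (Sum.inl b)
  /-- no edge connects two empty vertices -/
  not_empty_empty : ∀ x y : Fin k ⊕ Fin q, ¬ graph.Adj (Sum.inr x) (Sum.inr y)
  /-- every leg of a full vertex is the end of exactly one edge -/
  leg : ∀ a : Leg p, ∃! x, graph.Adj (Sum.inl a) x
  /-- every inner empty vertex is met by some edge -/
  inner : ∀ i : Fin k, ∃ x, graph.Adj (Sum.inr (Sum.inl i)) x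
  /-- every outer empty vertex is met by exactly one edge -/
  outer : ∀ o : Fin q, ∃! x, graph.Adj (Sum.inr (Sum.inr o)) x

namespace LabelledGraph

variable {m : ℕ} {p : Fin m → ℕ}

/-- Two labelled graphs are the same up to the labels of the inner empty vertices and the labels
of the outer empty vertices; the legs of the full vertices are kept fixed. -/
def Same (G H : LabelledGraph p) : Prop :=
  ∃ (e : Fin G.k ≃ Fin H.k) (o : Fin G.q ≃ Fin H.q), ∀ x y,
    G.graph.Adj x y ↔
      H.graph.Adj (Sum.map id (Sum.map e o) x) (Sum.map id (Sum.map e o) y)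

theorem same_equivalence : Equivalence (Same (p := p)) where
  refl G := ⟨Equiv.refl _, Equiv.refl _, fun x y => by simp⟩
  symm := by
    rintro G H ⟨e, o, h⟩
    refine ⟨e.symm, o.symm, fun x y => ?_⟩
    rw [h]
    rcases x with x | x | x <;> rcases y with y | y | y <;> simp
  trans := by
    rintro G H K ⟨e, o, h⟩ ⟨e', o', h'⟩
    refine ⟨e.trans e', o.trans o', fun x y => ?_⟩
    rw [h, h']
    rcases x with x | x | x <;> rcases y with y | y | y <;> simp

instance setoid (p : Fin m → ℕ) : Setoid (LabelledGraph p) := ⟨Same, same_equivalence⟩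

open Classical in
/-- The legs of full vertices that are connected with a given empty vertex. -/
def legsAt (G : LabelledGraph p) (x : Fin G.k ⊕ Fin G.q) : Finset (Leg p) :=
  Finset.univ.filter fun a => G.graph.Adj (Sum.inr x) (Sum.inl a)

/-- The value of a graph: sum over all assignments `X` of values in `{1, …, d}` to the legs of the
full vertices; each full vertex gives a factor `λ^{(p_j)}_X`, each outer empty vertex a factor
`φ_X` (there is exactly one leg connected with it), and each inner empty vertex a factor
`t C_X`. -/
def value {d : ℕ} (Ψ : (Fin d → ℂ) → ℂ) (lam : (p : ℕ) → (Fin p → Fin d) → ℝ) (t : ℝ)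
    (φ : Space d) (G : LabelledGraph p) : ℂ :=
  ∑ X : Leg p → Fin d,
    (∏ j : Fin m, ((lam (p j) (fun l => X ⟨j, l⟩) : ℝ) : ℂ)) *
    (∏ o : Fin G.q, ∏ b ∈ G.legsAt (Sum.inr o), ((φ (X b) : ℝ) : ℂ)) *
    ∏ i : Fin G.k, (t : ℂ) * symbolCoeff Ψ (G.legsAt (Sum.inl i)).card
      (fun r => X ((G.legsAt (Sum.inl i)).equivFin.symm r))

theorem value_congr {d : ℕ} (Ψ : (Fin d → ℂ) → ℂ) (lam : (p : ℕ) → (Fin p → Fin d) → ℝ) (t : ℝ)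
    (φ : Space d) {G H : LabelledGraph p} (h : G.Same H) :
    value Ψ lam t φ G = value Ψ lam t φ H := by
  obtain ⟨e, o, h⟩ := h
  have key : ∀ x, G.legsAt x = H.legsAt (Sum.map e o x) := by
    intro x
    ext a
    simp [legsAt, h]
  unfold value
  refine Finset.sum_congr rfl fun X _ => ?_
  congr 1
  · congr 1
    rw [← Equiv.prod_comp o]
    exact Finset.prod_congr rfl fun i _ => by rw [key]; rfl
  · rw [← Equiv.prod_comp e]
    exact Finset.prod_congr rfl fun i _ => by rw [key]; rfl

/-- A leg connected with a given empty vertex. -/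
theorem exists_leg (G : LabelledGraph p) (x : Fin G.k ⊕ Fin G.q) :
    ∃ a : Leg p, G.graph.Adj (Sum.inl a) (Sum.inr x) := by
  have : ∃ y, G.graph.Adj (Sum.inr x) y := by
    rcases x with i | o
    · exact G.inner i
    · exact (G.outer o).exists
  obtain ⟨y, hy⟩ := this
  rcases y with a | y
  · exact ⟨a, hy.symm⟩
  · exact absurd hy (G.not_empty_empty x y)

theorem card_le (G : LabelledGraph p) : G.k + G.q ≤ Fintype.card (Leg p) := by
  choose a ha using G.exists_leg
  have hinj : Function.Injective a := by
    intro x y hxy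
    have hy := ha y
    rw [← hxy] at hy
    exact Sum.inr_injective ((G.leg (a x)).unique (ha x) hy)
  simpa using Fintype.card_le_of_injective a hinj

instance finite (p : Fin m → ℕ) : Finite (LabelledGraph p) := by
  let n := Fintype.card (Leg p)
  let T : Type := Σ (k : Fin (n + 1)) (q : Fin (n + 1)), SimpleGraph (Endpoint p k q)
  let F : LabelledGraph p → T := fun G =>
    ⟨⟨G.k, by have := G.card_le; omega⟩, ⟨G.q, by have := G.card_le; omega⟩, G.graph⟩
  refine Finite.of_injective F ?_
  rintro ⟨k, q, g, _, _, _, _, _⟩ ⟨k', q', g', _, _, _, _, _⟩ h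
  have hk : k = k' := congrArg (fun z : T => (z.1 : ℕ)) h
  have hq : q = q' := congrArg (fun z : T => (z.2.1 : ℕ)) h
  subst hk
  subst hq
  have hg : g = g' := eq_of_heq (Sigma.mk.inj (eq_of_heq (Sigma.mk.inj h).2)).2
  subst hg
  rfl

end LabelledGraph

/-- The set of generalized amputated Feynman graphs with `m` inner full vertices, the `j`-th one
having `p_j ≤ pbar` legs with `λ^{(p_j)} ≠ 0`. The empty vertices are non-distinguishable. -/
def FeynmanGraph {d : ℕ} (pbar : ℕ) (lam : (p : ℕ) → (Fin p → Fin d) → ℝ) (m : ℕ) : Type :=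
  Σ p : {p : Fin m → Fin (pbar + 1) // ∀ j, lam (p j) ≠ 0},
    Quotient (LabelledGraph.setoid (fun j => (p.1 j : ℕ)))

instance FeynmanGraph.finite {d : ℕ} (pbar : ℕ) (lam : (p : ℕ) → (Fin p → Fin d) → ℝ) (m : ℕ) :
    Finite (FeynmanGraph pbar lam m) := by
  unfold FeynmanGraph
  infer_instance

instance FeynmanGraph.fintype {d : ℕ} (pbar : ℕ) (lam : (p : ℕ) → (Fin p → Fin d) → ℝ) (m : ℕ) :
    Fintype (FeynmanGraph pbar lam m) :=
  Fintype.ofFinite _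

/-- The value `𝒱[G](t, φ)` of a Feynman graph. -/
def FeynmanGraph.value {d pbar m : ℕ} {lam : (p : ℕ) → (Fin p → Fin d) → ℝ}
    (Ψ : (Fin d → ℂ) → ℂ) (G : FeynmanGraph pbar lam m) (t : ℝ) (φ : Space d) : ℂ :=
  Quotient.lift (LabelledGraph.value Ψ lam t φ)
    (fun _ _ h => LabelledGraph.value_congr Ψ lam t φ h) G.2

/-! ### Asymptotic series -/

/-- `∑ β^m a_m` is an asymptotic series for `h(β)`, `β > 0`, at `β = 0`. -/
def IsAsymptoticSeries (h : ℝ → ℂ) (a : ℕ → ℂ) : Prop :=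
  ∀ N : ℕ, Tendsto
    (fun β : ℝ => (β ^ N)⁻¹ * ‖h β - ∑ m ∈ Finset.range (N + 1), (β : ℂ) ^ m * a m‖)
    (𝓝[>] 0) (𝓝 0)

end FeynmanExpansion

end

/-!
On the Fourier side the Cauchy problem is the family of ordinary differential equations
`∂ₜ b = Ψ(-iξ) b`, one for each frequency `ξ`. Because `Re Ψ(-iξ)` grows at most logarithmically and
all derivatives of `Ψ(-iξ)` polynomially, `e^{tΨ(-iξ)}`, `t ≥ 0`, multiplies Schwartz functions, and
Taylor's formula in every seminorm shows that `t ↦ e^{tΨ(-iξ)} g` is differentiable in the Schwartz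
topology (`IsExpMultiplier.tendsto_slope_expMul`). This gives existence. For uniqueness one
differentiates `e^{-tΨ(-iξ)} b(t)` at a fixed frequency (`eq_nuConv_of_isCauchySolution`).

For fixed `t` and `φ` the number `(ν_t * f)(φ)` is the pairing of `f` with the symbol
`N(ξ) = e^{tΨ(-iξ) - i⟨ξ,φ⟩}` (`symbolPairing`). The function `β ↦ ⟨N, f_β⟩` is smooth on `(0, ∞)`
with derivatives `⟨N, (-V)^m f_β⟩`. Hence it has an asymptotic expansion at `0` if these derivatives
have limits as `β → 0` (`isAsymptoticSeries_of_hasDerivAt`). The limits exist: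

* Multiplication of the test function by a coordinate `x_i` amounts to applying `i ∂/∂ξ_i` to the
  symbol (`symbolPairing_inner_mul`), so that only limits of `⟨Q, f_β⟩` are needed, with `Q` of
  temperate growth.
* `⟨Q, f_β⟩ → Q(0)` (`tendsto_symbolPairing_schwartzDatum`). With `ε = β^{1/pbar}` one has
  `f_β(x) = e^{-V_ε}(εx)`, where `V_ε` has the leading part of `V` and smaller lower order
  coefficients. The functions `e^{-V_ε}` form a bounded set in the Schwartz space, and dilation
  replaces `Q(ξ)` by `Q(εξ)`, which differs from `Q(0)` by `ε` times a polynomial bound.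

So the `m`-th coefficient is a sum of derivatives of `N` at zero frequency, one derivative for each
leg of `m` full vertices. By the Leibniz rule these derivatives satisfy a recursion in the set of
legs (`zeroDeriv_insert_exp_convExponent`): the last leg contributes `φ_X` on its own, or forms a
block with some of the other legs, which contributes `t C_X`. The same recursion holds for the sum
over all sets of disjoint blocks of legs (`partitionSum_insert`). Such a set of blocks is the same as
a Feynman graph: a block consists of the legs which end at one inner empty vertex, and the legs
outside all blocks end at outer empty vertices (`LabelledGraph.quotientEquiv`).
-/

namespace FeynmanExpansion

open scoped ContDiff

section ExponentialFamily

/-! ### Derivatives with respect to a parameter -/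

/-- Derivatives in a parameter commute with iterated derivatives in the space variable. -/
theorem hasDerivAt_iteratedFDeriv_param {E F : Type} [NormedAddCommGroup E] [NormedSpace ℝ E]
    [NormedAddCommGroup F] [NormedSpace ℝ F] {G : ℝ × E → F} (hG : ContDiff ℝ (⊤ : ℕ∞) G)
    (n : ℕ) (s : ℝ) (x : E) :
    HasDerivAt (fun r => iteratedFDeriv ℝ n (fun y => G (r, y)) x)
      (iteratedFDeriv ℝ n (fun y => fderiv ℝ G (s, y) (1, 0)) x) s := by
  induction n generalizing F with
  | zero =>
    have h1 : HasDerivAt (fun r => G (r, x)) (fderiv ℝ G (s, x) (1, 0)) s :=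
      ((hG.differentiable (by simp)) (s, x)).hasFDerivAt.comp_hasDerivAt s
        ((hasDerivAt_id s).prodMk (hasDerivAt_const s x))
    have := ((continuousMultilinearCurryFin0 ℝ E F).symm.toContinuousLinearEquiv
      |>.toContinuousLinearMap.hasFDerivAt.comp_hasDerivAt s h1)
    exact this
  | succ n ih =>
    have hdG : ContDiff ℝ (⊤ : ℕ∞) (fderiv ℝ G) := hG.fderiv_right (by simp)
    set G' : ℝ × E → (E →L[ℝ] F) := fun z => (fderiv ℝ G z).comp (ContinuousLinearMap.inr ℝ ℝ E)
      with hG'def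
    have hG' : ContDiff ℝ (⊤ : ℕ∞) G' := by
      exact hdG.clm_comp contDiff_const
    have hfd : ∀ r y, fderiv ℝ (fun y => G (r, y)) y = G' (r, y) := by
      intro r y
      have : HasFDerivAt (fun y => G (r, y)) (G' (r, y)) y :=
        ((hG.differentiable (by simp)) (r, y)).hasFDerivAt.comp y (hasFDerivAt_prodMk_right r y)
      exact this.fderiv
    -- the two first derivatives commute because the second derivative of `G` is symmetric
    have hsymm : ∀ y, fderiv ℝ G' (s, y) (1, 0) =
        fderiv ℝ (fun y => fderiv ℝ G (s, y) (1, 0)) y := by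
      intro y
      have h2 : HasFDerivAt (fderiv ℝ G) (fderiv ℝ (fderiv ℝ G) (s, y)) (s, y) :=
        ((hdG.differentiable (by simp)) (s, y)).hasFDerivAt
      have hsy : IsSymmSndFDerivAt ℝ G (s, y) :=
        (hG.contDiffAt).isSymmSndFDerivAt (by simp; exact WithTop.coe_le_coe.2 le_top)
      have h3 : HasFDerivAt G' (((ContinuousLinearMap.compL ℝ E (ℝ × E) F).flip
          (ContinuousLinearMap.inr ℝ ℝ E)).comp (fderiv ℝ (fderiv ℝ G) (s, y))) (s, y) :=
        ((ContinuousLinearMap.compL ℝ E (ℝ × E) F).flip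
          (ContinuousLinearMap.inr ℝ ℝ E)).hasFDerivAt.comp (s, y) h2
      have h4 : HasFDerivAt (fun y => fderiv ℝ G (s, y) (1, 0))
          ((ContinuousLinearMap.apply ℝ F ((1 : ℝ), (0 : E))).comp
            ((fderiv ℝ (fderiv ℝ G) (s, y)).comp (ContinuousLinearMap.inr ℝ ℝ E))) y :=
        (ContinuousLinearMap.apply ℝ F ((1 : ℝ), (0 : E))).hasFDerivAt.comp y
          (h2.comp y (hasFDerivAt_prodMk_right s y))
      rw [h3.fderiv, h4.fderiv]
      ext v
      simpa using hsy (1, 0) (0, v)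
    have := ih hG'
    have key := ((continuousMultilinearCurryRightEquiv' ℝ n E F).symm.toContinuousLinearEquiv
      |>.toContinuousLinearMap.hasFDerivAt.comp_hasDerivAt s this)
    have e1 : (fun r => iteratedFDeriv ℝ (n + 1) (fun y => G (r, y)) x) =
        (continuousMultilinearCurryRightEquiv' ℝ n E F).symm ∘
          fun r => iteratedFDeriv ℝ n (fun y => G' (r, y)) x := by
      funext r
      rw [iteratedFDeriv_succ_eq_comp_right, Function.comp_apply, Function.comp_apply]
      congr 2
      funext y
      exact hfd r y
    have e2 : iteratedFDeriv ℝ (n + 1) (fun y => fderiv ℝ G (s, y) (1, 0)) x =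
        (continuousMultilinearCurryRightEquiv' ℝ n E F).symm
          (iteratedFDeriv ℝ n (fun y => fderiv ℝ G' (s, y) (1, 0)) x) := by
      rw [iteratedFDeriv_succ_eq_comp_right, Function.comp_apply]
      congr 2
      funext y
      exact (hsymm y).symm
    rw [e1, e2]
    exact key

/-! ### Families of exponentials -/

variable {E : Type} [NormedAddCommGroup E] [NormedSpace ℝ E]

/-- A smooth symbol all of whose derivatives grow polynomially and whose exponential grows
polynomially as well, so that `e^{sψ}`, `s ≥ 0`, are multipliers of the Schwartz space. -/
structure IsExpMultiplier (ψ : E → ℂ) : Prop where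
  temperate : ψ.HasTemperateGrowth
  exp_le : ∃ (N : ℕ) (C : ℝ), ∀ x, Real.exp (ψ x).re ≤ C * (1 + ‖x‖) ^ N

/-- The bound for the outer function in the Faà di Bruno estimate of `e^{sψ}`. -/
theorem norm_iteratedFDeriv_cexp (n : ℕ) (z : ℂ) :
    ‖iteratedFDeriv ℝ n Complex.exp z‖ = Real.exp z.re := by
  have h := (Complex.contDiff_exp (𝕜 := ℂ) (n := (n : ℕ∞ω))).contDiffAt (x := z)
  rw [← h.restrictScalars_iteratedFDeriv (𝕜 := ℝ)]
  simp only [Function.comp_apply, ContinuousMultilinearMap.norm_restrictScalars]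
  rw [norm_iteratedFDeriv_eq_norm_iteratedDeriv]
  simp [iteratedDeriv_eq_iterate, Complex.norm_exp]

theorem IsExpMultiplier.exists_exp_le {ψ : E → ℂ} (h : IsExpMultiplier ψ) (T : ℝ) :
    ∃ (N : ℕ) (C : ℝ), 0 ≤ C ∧ ∀ s ∈ Set.Icc 0 T, ∀ x,
      Real.exp (s * (ψ x).re) ≤ C * (1 + ‖x‖) ^ N := by
  obtain ⟨N, C, hC⟩ := h.exp_le
  obtain ⟨k, hk⟩ := exists_nat_ge T
  refine ⟨N * k, (max C 1) ^ k, by positivity, fun s hs x => ?_⟩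
  have h1 : (1 : ℝ) ≤ (1 + ‖x‖) ^ N := one_le_pow₀ (by linarith [norm_nonneg x])
  have hb : max (ψ x).re 0 ≤ Real.log (max C 1 * (1 + ‖x‖) ^ N) := by
    refine max_le ?_ (Real.log_nonneg ?_)
    · rw [Real.le_log_iff_exp_le (by positivity)]
      exact (hC x).trans (by gcongr; exact le_max_left _ _)
    · exact one_le_mul_of_one_le_of_one_le (le_max_right _ _) h1
  have hs' : s * (ψ x).re ≤ k * max (ψ x).re 0 := by
    calc s * (ψ x).re ≤ s * max (ψ x).re 0 := by
          gcongr
          · exact hs.1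
          · exact le_max_left _ _
      _ ≤ k * max (ψ x).re 0 := by
          gcongr
          exact hs.2.trans hk
  calc Real.exp (s * (ψ x).re) ≤ Real.exp (k * Real.log (max C 1 * (1 + ‖x‖) ^ N)) := by
        apply Real.exp_le_exp.2
        exact hs'.trans (by gcongr)
    _ = (max C 1 * (1 + ‖x‖) ^ N) ^ k := by
        rw [Real.exp_nat_mul, Real.exp_log (by positivity)]
    _ = _ := by rw [mul_pow, pow_mul]

/-- The derivatives of `e^{sψ}` grow polynomially, uniformly for `s` in a bounded interval. -/
theorem IsExpMultiplier.exists_norm_iteratedFDeriv_exp_le {ψ : E → ℂ} (h : IsExpMultiplier ψ)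
    (T : ℝ) (n : ℕ) :
    ∃ (N : ℕ) (C : ℝ), 0 ≤ C ∧ ∀ s ∈ Set.Icc 0 T, ∀ x,
      ‖iteratedFDeriv ℝ n (fun y => Complex.exp (s * ψ y)) x‖ ≤ C * (1 + ‖x‖) ^ N := by
  obtain ⟨N, C, hC0, hC⟩ := h.exists_exp_le T
  obtain ⟨k, B, hB0, hB⟩ := h.temperate.norm_iteratedFDeriv_le_uniform n
  refine ⟨N + k * n, n.factorial * C * (max 1 (|T| * B)) ^ n, by positivity, fun s hs x => ?_⟩
  have hψ := h.temperate.1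
  have hsψ : ContDiff ℝ (⊤ : ℕ∞) (fun y => (s : ℂ) * ψ y) := contDiff_const.mul hψ
  have h1 : (1 : ℝ) ≤ 1 + ‖x‖ := by linarith [norm_nonneg x]
  have key := norm_iteratedFDeriv_comp_le (𝕜 := ℝ) (g := Complex.exp)
    (f := fun y => (s : ℂ) * ψ y) (n := n) (N := ((⊤ : ℕ∞) : ℕ∞ω))
    Complex.contDiff_exp hsψ (WithTop.coe_le_coe.2 le_top) x
    (C := C * (1 + ‖x‖) ^ N) (D := max 1 (|T| * B) * (1 + ‖x‖) ^ k)
    (fun i _ => by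
      rw [norm_iteratedFDeriv_cexp]
      simpa using hC s hs x)
    (fun i hi hin => by
      have e : (fun y => (s : ℂ) * ψ y) = fun y => s • ψ y := by
        funext y; simp
      rw [show (fun y => s • ψ y) = s • ψ from rfl] at e
      rw [e, iteratedFDeriv_const_smul_apply (hψ.of_le (WithTop.coe_le_coe.2 le_top)).contDiffAt,
        norm_smul]
      have : (1 : ℝ) ≤ max 1 (|T| * B) * (1 + ‖x‖) ^ k :=
        one_le_mul_of_one_le_of_one_le (le_max_left _ _) (one_le_pow₀ h1)
      calc ‖s‖ * ‖iteratedFDeriv ℝ i ψ x‖ ≤ |T| * (B * (1 + ‖x‖) ^ k) := by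
            gcongr
            · rw [Real.norm_eq_abs, abs_of_nonneg hs.1]
              exact hs.2.trans (le_abs_self T)
            · exact hB i hin x
        _ ≤ max 1 (|T| * B) * (1 + ‖x‖) ^ k := by
            rw [← mul_assoc]
            gcongr
            exact le_max_right _ _
        _ ≤ _ := le_self_pow₀ this (by omega))
  refine key.trans (le_of_eq ?_)
  rw [mul_pow, pow_add, ← pow_mul]
  ring

theorem IsExpMultiplier.temperate_exp {ψ : E → ℂ} (h : IsExpMultiplier ψ) {s : ℝ} (hs : 0 ≤ s) :
    (fun y => Complex.exp (s * ψ y)).HasTemperateGrowth := by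
  refine ⟨Complex.contDiff_exp.comp (contDiff_const.mul h.temperate.1), fun n => ?_⟩
  obtain ⟨N, C, -, hC⟩ := h.exists_norm_iteratedFDeriv_exp_le s n
  exact ⟨N, C, hC s ⟨hs, le_rfl⟩⟩

/-- Multiplication of Schwartz functions by `e^{sψ}`. For `s < 0` the multiplier need not have
temperate growth, and then the value is the zero operator. -/
noncomputable def expMul (ψ : E → ℂ) (s : ℝ) : 𝓢(E, ℂ) →L[ℂ] 𝓢(E, ℂ) :=
  SchwartzMap.smulLeftCLM ℂ (fun y => Complex.exp (s * ψ y))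

theorem IsExpMultiplier.expMul_apply {ψ : E → ℂ} (h : IsExpMultiplier ψ) {s : ℝ} (hs : 0 ≤ s)
    (g : 𝓢(E, ℂ)) (x : E) : expMul ψ s g x = Complex.exp (s * ψ x) * g x := by
  simp [expMul, SchwartzMap.smulLeftCLM_apply_apply (h.temperate_exp hs)]

theorem IsExpMultiplier.exists_seminorm_expMul_le {ψ : E → ℂ} (h : IsExpMultiplier ψ) (T : ℝ)
    (g : 𝓢(E, ℂ)) (k n : ℕ) :
    ∃ C : ℝ, 0 ≤ C ∧ ∀ s ∈ Set.Icc 0 T, ∀ x,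
      ‖x‖ ^ k * ‖iteratedFDeriv ℝ n (fun y => Complex.exp (s * ψ y) * g y) x‖ ≤ C := by
  choose N C hC0 hC using fun i => h.exists_norm_iteratedFDeriv_exp_le T i
  have hg : ∀ i j : ℕ, ∃ B : ℝ, 0 ≤ B ∧ ∀ x, ‖x‖ ^ k * (1 + ‖x‖) ^ j *
      ‖iteratedFDeriv ℝ i g x‖ ≤ B := by
    intro i j
    refine ⟨2 ^ (k + j) * (Finset.Iic (k + j, i)).sup
      (fun m => SchwartzMap.seminorm ℝ m.1 m.2) g, by positivity, fun x => ?_⟩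
    refine le_trans ?_ (SchwartzMap.one_add_le_sup_seminorm_apply (𝕜 := ℝ) (m := (k + j, i))
      le_rfl le_rfl g x)
    rw [pow_add]
    gcongr
    linarith [norm_nonneg x]
  choose B hB0 hB using hg
  refine ⟨∑ i ∈ Finset.range (n + 1), n.choose i * (C i * B (n - i) (N i)),
    Finset.sum_nonneg fun i _ => mul_nonneg (by positivity) (mul_nonneg (hC0 i) (hB0 _ _)),
    fun s hs x => ?_⟩
  have hsm : ContDiff ℝ (⊤ : ℕ∞) (fun y => Complex.exp (s * ψ y)) := (h.temperate_exp hs.1).1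
  have := norm_iteratedFDeriv_mul_le (𝕜 := ℝ) hsm (g.smooth ⊤) x (n := n)
    (WithTop.coe_le_coe.2 le_top)
  calc _ ≤ ‖x‖ ^ k * ∑ i ∈ Finset.range (n + 1), (n.choose i : ℝ) *
        ‖iteratedFDeriv ℝ i (fun y => Complex.exp (s * ψ y)) x‖ *
        ‖iteratedFDeriv ℝ (n - i) g x‖ := by gcongr
    _ ≤ _ := by
      rw [Finset.mul_sum]
      refine Finset.sum_le_sum fun i _ => ?_
      calc _ ≤ ‖x‖ ^ k * ((n.choose i : ℝ) * (C i * (1 + ‖x‖) ^ N i) *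
            ‖iteratedFDeriv ℝ (n - i) g x‖) := by
            gcongr
            exact hC i s hs x
        _ = n.choose i * (C i * (‖x‖ ^ k * (1 + ‖x‖) ^ N i *
            ‖iteratedFDeriv ℝ (n - i) g x‖)) := by ring
        _ ≤ _ := by
            have := hC0 i
            gcongr
            exact hB _ _ x

theorem hasDerivAt_iteratedFDeriv_exp_mul {ψ g : E → ℂ} (hψ : ContDiff ℝ (⊤ : ℕ∞) ψ)
    (hg : ContDiff ℝ (⊤ : ℕ∞) g) (n : ℕ) (s : ℝ) (x : E) :
    HasDerivAt (fun r : ℝ => iteratedFDeriv ℝ n (fun y => Complex.exp (r * ψ y) * g y) x)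
      (iteratedFDeriv ℝ n (fun y => Complex.exp (s * ψ y) * (ψ y * g y)) x) s := by
  set G : ℝ × E → ℂ := fun z => Complex.exp (z.1 * ψ z.2) * g z.2 with hGdef
  have hG : ContDiff ℝ (⊤ : ℕ∞) G := by
    have h1 : ContDiff ℝ (⊤ : ℕ∞) (fun z : ℝ × E => (z.1 : ℂ)) :=
      Complex.ofRealCLM.contDiff.comp contDiff_fst
    exact (Complex.contDiff_exp.comp (h1.mul (hψ.comp contDiff_snd))).mul (hg.comp contDiff_snd)
  have := hasDerivAt_iteratedFDeriv_param hG n s x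
  have e : (fun y => fderiv ℝ G (s, y) (1, 0)) =
      fun y => Complex.exp (s * ψ y) * (ψ y * g y) := by
    funext y
    have h1 : HasDerivAt (fun r => G (r, y)) (fderiv ℝ G (s, y) (1, 0)) s :=
      (((hG.differentiable (by simp)) (s, y)).hasFDerivAt).comp_hasDerivAt (f := fun r => (r, y)) s
        ((hasDerivAt_id s).prodMk (hasDerivAt_const s y))
    have h2 : HasDerivAt (fun r : ℝ => G (r, y)) (Complex.exp (s * ψ y) * (ψ y * g y)) s := by
      have h3 : HasDerivAt (fun r : ℝ => (r : ℂ) * ψ y) (1 * ψ y) s :=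
        (Complex.ofRealCLM.hasDerivAt (x := s)).mul_const (ψ y)
      have h4 := h3.cexp.mul_const (g y)
      rw [one_mul, mul_assoc] at h4
      exact h4
    exact h1.unique h2
  rw [e] at this
  exact this

/-- The second order remainder of a curve with bounded second derivative. -/
theorem norm_sub_sub_smul_le_of_deriv2 {F : Type} [NormedAddCommGroup F] [NormedSpace ℝ F]
    {γ γ' γ'' : ℝ → F} {a b C : ℝ} {t : ℝ} (ht : t ∈ Set.Icc a b)
    (h1 : ∀ r ∈ Set.Icc a b, HasDerivAt γ (γ' r) r)
    (h2 : ∀ r ∈ Set.Icc a b, HasDerivAt γ' (γ'' r) r)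
    (hC : ∀ r ∈ Set.Icc a b, ‖γ'' r‖ ≤ C) {s : ℝ} (hs : s ∈ Set.Icc a b) :
    ‖γ s - γ t - (s - t) • γ' t‖ ≤ C * ‖s - t‖ ^ 2 := by
  have hC0 : 0 ≤ C := (norm_nonneg _).trans (hC t ht)
  have hsub : Set.uIcc t s ⊆ Set.Icc a b := Set.uIcc_subset_Icc ht hs
  have hd : ∀ r ∈ Set.uIcc t s, ‖γ' r - γ' t‖ ≤ C * ‖s - t‖ := by
    intro r hr
    have := (convex_Icc a b).norm_image_sub_le_of_norm_hasDerivWithin_le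
      (fun r hr => (h2 r hr).hasDerivWithinAt) hC ht (hsub hr)
    refine this.trans ?_
    gcongr
    exact Set.abs_sub_left_of_mem_uIcc hr
  have h3 : ∀ r ∈ Set.uIcc t s, HasDerivWithinAt (fun r => γ r - (r - t) • γ' t)
      (γ' r - (1 : ℝ) • γ' t) (Set.uIcc t s) r := by
    intro r hr
    exact ((h1 r (hsub hr)).sub (((hasDerivAt_id r).sub_const t).smul_const _)).hasDerivWithinAt
  have := (convex_uIcc t s).norm_image_sub_le_of_norm_hasDerivWithin_le h3
    (fun r hr => by simpa using hd r hr) Set.left_mem_uIcc Set.right_mem_uIcc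
  calc _ = ‖γ s - (s - t) • γ' t - (γ t - (t - t) • γ' t)‖ := by
        congr 1
        simp
        abel
    _ ≤ C * ‖s - t‖ * ‖s - t‖ := this
    _ = _ := by ring

/-- The Taylor remainder of second order of `s ↦ e^{sψ} g` in every Schwartz seminorm: pointwise it
is controlled by the second derivative `e^{sψ} ψ² g`. -/
theorem IsExpMultiplier.exists_seminorm_remainder_le {ψ : E → ℂ} (h : IsExpMultiplier ψ) {T : ℝ}
    (g : 𝓢(E, ℂ)) (k n : ℕ) :
    ∃ C : ℝ, ∀ s ∈ Set.Icc 0 T, ∀ t ∈ Set.Icc 0 T,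
      SchwartzMap.seminorm ℝ k n (expMul ψ s g - expMul ψ t g -
        (s - t) • expMul ψ t (SchwartzMap.smulLeftCLM ℂ ψ g)) ≤ C * ‖s - t‖ ^ 2 := by
  set g₁ := SchwartzMap.smulLeftCLM ℂ ψ g with hg₁
  set g₂ := SchwartzMap.smulLeftCLM ℂ ψ g₁ with hg₂
  have hg₁' : ∀ y, g₁ y = ψ y * g y := fun y => by
    simp [hg₁, SchwartzMap.smulLeftCLM_apply_apply h.temperate]
  have hg₂' : ∀ y, g₂ y = ψ y * g₁ y := fun y => by
    simp [hg₂, SchwartzMap.smulLeftCLM_apply_apply h.temperate]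
  obtain ⟨C, hC0, hC⟩ := h.exists_seminorm_expMul_le T g₂ k n
  refine ⟨C, fun s hs t ht => SchwartzMap.seminorm_le_bound ℝ k n _ (by positivity) fun x => ?_⟩
  have hcoe : ∀ (r : ℝ) (f : 𝓢(E, ℂ)), 0 ≤ r →
      (expMul ψ r f : E → ℂ) = fun y => Complex.exp (r * ψ y) * f y := fun r f hr => by
    funext y
    exact h.expMul_apply hr f y
  have h1 : ∀ r ∈ Set.Icc (0:ℝ) T, HasDerivAt
      (fun r : ℝ => ‖x‖ ^ k • iteratedFDeriv ℝ n (fun y => Complex.exp (r * ψ y) * g y) x)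
      (‖x‖ ^ k • iteratedFDeriv ℝ n (fun y => Complex.exp (r * ψ y) * g₁ y) x) r := by
    intro r hr
    have := hasDerivAt_iteratedFDeriv_exp_mul h.temperate.1 (g.smooth ⊤) n r x
    simp only [← hg₁'] at this
    exact this.fun_const_smul (‖x‖ ^ k)
  have h2 : ∀ r ∈ Set.Icc (0:ℝ) T, HasDerivAt
      (fun r : ℝ => ‖x‖ ^ k • iteratedFDeriv ℝ n (fun y => Complex.exp (r * ψ y) * g₁ y) x)
      (‖x‖ ^ k • iteratedFDeriv ℝ n (fun y => Complex.exp (r * ψ y) * g₂ y) x) r := by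
    intro r hr
    have := hasDerivAt_iteratedFDeriv_exp_mul h.temperate.1 (g₁.smooth ⊤) n r x
    simp only [← hg₂'] at this
    exact this.fun_const_smul (‖x‖ ^ k)
  have key := norm_sub_sub_smul_le_of_deriv2 ht h1 h2 (fun r hr => by
    rw [norm_smul, norm_pow, norm_norm]
    exact hC r hr x) hs
  refine le_trans (le_of_eq ?_) key
  have hs1 : ContDiffAt ℝ n (expMul ψ s g : E → ℂ) x := ((expMul ψ s g).smooth n).contDiffAt
  have ht1 : ContDiffAt ℝ n (expMul ψ t g : E → ℂ) x := ((expMul ψ t g).smooth n).contDiffAt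
  have ht2 : ContDiffAt ℝ n (expMul ψ t g₁ : E → ℂ) x := ((expMul ψ t g₁).smooth n).contDiffAt
  have hst : ContDiffAt ℝ n ((expMul ψ s g : E → ℂ) - (expMul ψ t g : E → ℂ)) x := hs1.sub ht1
  have hct : ContDiffAt ℝ n ((s - t) • (expMul ψ t g₁ : E → ℂ)) x := ht2.const_smul (s - t)
  have e1 : iteratedFDeriv ℝ n (expMul ψ s g - expMul ψ t g - (s - t) • expMul ψ t g₁ : 𝓢(E, ℂ)) x
      = iteratedFDeriv ℝ n (expMul ψ s g) x - iteratedFDeriv ℝ n (expMul ψ t g) x -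
        (s - t) • iteratedFDeriv ℝ n (expMul ψ t g₁) x := by
    have e0 : ((expMul ψ s g - expMul ψ t g - (s - t) • expMul ψ t g₁ : 𝓢(E, ℂ)) : E → ℂ) =
        (expMul ψ s g : E → ℂ) - (expMul ψ t g : E → ℂ) - (s - t) • (expMul ψ t g₁ : E → ℂ) := rfl
    rw [e0, iteratedFDeriv_sub_apply hst hct,
      iteratedFDeriv_sub_apply hs1 ht1, iteratedFDeriv_const_smul_apply ht2]
  rw [e1, ← norm_norm x, ← norm_pow, ← norm_smul, hcoe s g hs.1, hcoe t g ht.1, hcoe t g₁ ht.1]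
  congr 1
  rw [smul_sub, smul_sub, smul_comm (s - t), norm_pow, norm_norm]

/-- `s ↦ e^{sψ} g` is differentiable on `[0, ∞)` in the Schwartz topology. -/
theorem IsExpMultiplier.tendsto_slope_expMul {ψ : E → ℂ} (h : IsExpMultiplier ψ)
    (g : 𝓢(E, ℂ)) {t : ℝ} (ht : 0 ≤ t) :
    Tendsto (fun s : ℝ => (s - t)⁻¹ • (expMul ψ s g - expMul ψ t g)) (𝓝[Set.Ici 0 \ {t}] t)
      (𝓝 (expMul ψ t (SchwartzMap.smulLeftCLM ℂ ψ g))) := by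
  rw [(schwartz_withSeminorms ℝ E ℂ).tendsto_nhds _ _]
  rintro ⟨k, n⟩ ε hε
  obtain ⟨C, hC⟩ := h.exists_seminorm_remainder_le (T := t + 1) g k n
  have h1 : Tendsto (fun s : ℝ => C * ‖s - t‖) (𝓝[Set.Ici 0 \ {t}] t) (𝓝 0) := by
    have : Continuous (fun s : ℝ => C * ‖s - t‖) := by fun_prop
    have := (this.tendsto t).mono_left (nhdsWithin_le_nhds (s := Set.Ici 0 \ {t}))
    simpa using this
  have h2 : ∀ᶠ s in 𝓝[Set.Ici 0 \ {t}] t, s < t + 1 :=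
    nhdsWithin_le_nhds (Iio_mem_nhds (by linarith))
  filter_upwards [h1.eventually (gt_mem_nhds hε), h2, self_mem_nhdsWithin] with s hs1 hs2 hs3
  have hst : s - t ≠ 0 := sub_ne_zero.2 hs3.2
  have e : (s - t)⁻¹ • (expMul ψ s g - expMul ψ t g) -
      expMul ψ t (SchwartzMap.smulLeftCLM ℂ ψ g) = (s - t)⁻¹ • (expMul ψ s g - expMul ψ t g -
        (s - t) • expMul ψ t (SchwartzMap.smulLeftCLM ℂ ψ g)) := by
    rw [smul_sub (s - t)⁻¹ (_ - _) (_ • _), smul_smul, inv_mul_cancel₀ hst, one_smul]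
  rw [e, map_smul_eq_mul]
  have := hC s ⟨hs3.1, hs2.le⟩ t ⟨ht, by linarith⟩
  refine lt_of_le_of_lt ?_ hs1
  rw [norm_inv]
  have hn : 0 < ‖s - t‖ := norm_pos_iff.2 hst
  rw [inv_mul_le_iff₀ hn]
  refine this.trans (le_of_eq (by ring))

theorem IsExpMultiplier.tendsto_expMul {ψ : E → ℂ} (h : IsExpMultiplier ψ)
    (g : 𝓢(E, ℂ)) {t : ℝ} (ht : 0 ≤ t) :
    Tendsto (fun s : ℝ => expMul ψ s g) (𝓝[Set.Ici 0 \ {t}] t) (𝓝 (expMul ψ t g)) := by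
  have h1 : Tendsto (fun s : ℝ => s - t) (𝓝[Set.Ici 0 \ {t}] t) (𝓝 0) := by
    have : Continuous (fun s : ℝ => s - t) := by fun_prop
    have := (this.tendsto t).mono_left (nhdsWithin_le_nhds (s := Set.Ici 0 \ {t}))
    simpa using this
  have h2 := (h1.smul (h.tendsto_slope_expMul g ht)).add_const (expMul ψ t g)
  rw [zero_smul, zero_add] at h2
  refine h2.congr' ?_
  filter_upwards [self_mem_nhdsWithin] with s hs
  rw [smul_smul, mul_inv_cancel₀ (sub_ne_zero.2 hs.2), one_smul, sub_add_cancel]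

end ExponentialFamily

section FourierTransform
open scoped FourierTransform

/-! ### The Fourier transform on Schwartz functions -/

variable {d : ℕ}

/-- Multiplication by `c ≠ 0` on the space of positions. -/
noncomputable def dilation (d : ℕ) {c : ℝ} (hc : c ≠ 0) : Space d ≃L[ℝ] Space d :=
  ContinuousLinearEquiv.smulLeft (Units.mk0 c hc)

@[simp]
theorem dilation_apply {c : ℝ} (hc : c ≠ 0) (x : Space d) : dilation d hc x = c • x := rfl

theorem two_pi_ne_zero : 2 * Real.pi ≠ 0 := by positivity

/-- The transform `fourier` as a continuous operator on Schwartz functions. -/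
noncomputable def schwartzFourier (d : ℕ) : 𝓢(Space d, ℂ) →L[ℂ] 𝓢(Space d, ℂ) :=
  (SchwartzMap.compCLMOfContinuousLinearEquiv ℂ (dilation d (inv_ne_zero two_pi_ne_zero))).comp
    (FourierTransform.fourierInvCLM ℂ 𝓢(Space d, ℂ))

/-- The transform `fourierInv` as a continuous operator on Schwartz functions. -/
noncomputable def schwartzFourierInv (d : ℕ) : 𝓢(Space d, ℂ) →L[ℂ] 𝓢(Space d, ℂ) :=
  (FourierTransform.fourierCLM ℂ 𝓢(Space d, ℂ)).comp
    (SchwartzMap.compCLMOfContinuousLinearEquiv ℂ (dilation d two_pi_ne_zero))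

theorem schwartzFourier_coe (g : 𝓢(Space d, ℂ)) : (schwartzFourier d g : Space d → ℂ) =
    fourier g := by
  funext ξ
  have h1 : schwartzFourier d g ξ = 𝓕⁻ (g : Space d → ℂ) ((2 * Real.pi)⁻¹ • ξ) := by
    rw [← SchwartzMap.fourierInv_coe]
    rfl
  rw [h1, Real.fourierInv_eq']
  unfold fourier
  refine integral_congr_ae (Eventually.of_forall fun x => ?_)
  simp only [smul_eq_mul]
  rw [mul_comm, inner_smul_right, ← mul_assoc, mul_inv_cancel₀ two_pi_ne_zero, one_mul,
    mul_comm _ Complex.I, real_inner_comm]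

theorem schwartzFourierInv_coe (g : 𝓢(Space d, ℂ)) :
    (schwartzFourierInv d g : Space d → ℂ) = fourierInv g := by
  funext x
  have h1 : schwartzFourierInv d g x =
      𝓕 (fun ξ : Space d => g ((2 * Real.pi) • ξ)) x := rfl
  rw [h1, Real.fourier_eq']
  unfold fourierInv
  have h2 := Measure.integral_comp_smul (volume : Measure (Space d))
    (fun ξ => g ξ * Complex.exp (-Complex.I * (inner ℝ ξ x : ℝ))) (2 * Real.pi)
  rw [finrank_euclideanSpace_fin, abs_of_pos (by positivity), Complex.real_smul] at h2
  push_cast at h2 ⊢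
  rw [inv_pow, ← h2]
  refine integral_congr_ae (Eventually.of_forall fun ξ => ?_)
  simp only [smul_eq_mul, inner_smul_left]
  rw [mul_comm]
  congr 2
  push_cast
  simp
  ring

theorem schwartzFourier_apply_inv (g : 𝓢(Space d, ℂ)) :
    schwartzFourier d (schwartzFourierInv d g) = g := by
  ext ξ
  change (𝓕⁻ (𝓕 (SchwartzMap.compCLMOfContinuousLinearEquiv ℂ (dilation d two_pi_ne_zero) g)))
    ((2 * Real.pi)⁻¹ • ξ) = g ξ
  rw [FourierTransform.fourierInv_fourier_eq]
  change g ((2 * Real.pi) • (2 * Real.pi)⁻¹ • ξ) = g ξ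
  rw [smul_smul, mul_inv_cancel₀ two_pi_ne_zero, one_smul]

theorem schwartzFourierInv_apply_fourier (g : 𝓢(Space d, ℂ)) :
    schwartzFourierInv d (schwartzFourier d g) = g := by
  have : SchwartzMap.compCLMOfContinuousLinearEquiv ℂ (dilation d two_pi_ne_zero)
      (schwartzFourier d g) = 𝓕⁻ g := by
    ext ξ
    change 𝓕⁻ g ((2 * Real.pi)⁻¹ • (2 * Real.pi) • ξ) = 𝓕⁻ g ξ
    rw [smul_smul, inv_mul_cancel₀ two_pi_ne_zero, one_smul]
  change 𝓕 (SchwartzMap.compCLMOfContinuousLinearEquiv ℂ (dilation d two_pi_ne_zero)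
      (schwartzFourier d g)) = g
  rw [this, FourierTransform.fourier_fourierInv_eq]

theorem inner_hasTemperateGrowth (m : Space d) :
    (fun x : Space d => ((inner ℝ x m : ℝ) : ℂ)).HasTemperateGrowth := by
  have h : (fun x : Space d => (inner ℝ x m : ℝ)).HasTemperateGrowth := by fun_prop
  exact Function.HasTemperateGrowth.comp Function.Complex.hasTemperateGrowth_ofReal h

/-- Multiplication by a linear form becomes differentiation on the Fourier side. -/
theorem schwartzFourier_inner_mul (g : 𝓢(Space d, ℂ)) (m : Space d) (ξ : Space d) :
    schwartzFourier d (SchwartzMap.smulLeftCLM ℂ (fun x : Space d => ((inner ℝ x m : ℝ) : ℂ)) g) ξ =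
      -Complex.I * fderiv ℝ (schwartzFourier d g) ξ m := by
  have h1 : LineDeriv.lineDerivOp m (schwartzFourier d g) = Complex.I •
      schwartzFourier d (SchwartzMap.smulLeftCLM ℂ
        (fun x : Space d => ((inner ℝ x m : ℝ) : ℂ)) g) := by
    have e : (2 * Real.pi * Complex.I) • SchwartzMap.smulLeftCLM ℂ
          (fun x : Space d => (inner ℝ x ((2 * Real.pi)⁻¹ • m) : ℝ)) g =
        Complex.I • SchwartzMap.smulLeftCLM ℂ
          (fun x : Space d => ((inner ℝ x m : ℝ) : ℂ)) g := by
      ext x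
      have ha : (fun x : Space d => (inner ℝ x ((2 * Real.pi)⁻¹ • m) : ℝ)).HasTemperateGrowth := by
        fun_prop
      rw [smul_apply, smul_apply, SchwartzMap.smulLeftCLM_apply_apply ha,
        SchwartzMap.smulLeftCLM_apply_apply (inner_hasTemperateGrowth m), inner_smul_right,
        Complex.real_smul]
      have := two_pi_ne_zero
      have h2 : (Real.pi : ℂ) ≠ 0 := by exact_mod_cast Real.pi_ne_zero
      simp only [smul_eq_mul]
      push_cast
      field_simp
    change LineDeriv.lineDerivOp m (SchwartzMap.compCLMOfContinuousLinearEquiv ℂ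
      (dilation d (inv_ne_zero two_pi_ne_zero)) (𝓕⁻ g)) = _
    rw [SchwartzMap.lineDerivOp_compCLMOfContinuousLinearEquiv, dilation_apply,
      SchwartzMap.lineDerivOp_fourierInv_eq, e, ← map_smul (schwartzFourier d)]
    rfl
  have h2 := congrArg (fun f : 𝓢(Space d, ℂ) => f ξ) h1
  simp only [SchwartzMap.lineDerivOp_apply_eq_fderiv, smul_apply, smul_eq_mul] at h2
  rw [h2, ← mul_assoc]
  simp

/-! ### Pairing with a symbol of temperate growth -/

/-- The tempered distribution with symbol `N`, evaluated on `g`: the functional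
`g ↦ (2π)^{-d} ∫ N(ξ) ℱ g(ξ) dξ`. -/
noncomputable def symbolPairing (N : Space d → ℂ) : 𝓢(Space d, ℂ) →L[ℂ] ℂ :=
  (((2 * Real.pi : ℝ) : ℂ)⁻¹ ^ d) • (SchwartzMap.integralCLM ℂ volume).comp
    ((SchwartzMap.smulLeftCLM ℂ N).comp (schwartzFourier d))

theorem symbolPairing_apply {N : Space d → ℂ} (hN : N.HasTemperateGrowth) (g : 𝓢(Space d, ℂ)) :
    symbolPairing N g = ((2 * Real.pi : ℝ) : ℂ)⁻¹ ^ d * ∫ ξ, N ξ * schwartzFourier d g ξ := by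
  simp [symbolPairing, SchwartzMap.integralCLM_apply, SchwartzMap.smulLeftCLM_apply_apply hN]

theorem symbolPairing_one (g : 𝓢(Space d, ℂ)) : symbolPairing (fun _ => 1) g = g 0 := by
  rw [symbolPairing_apply (by fun_prop)]
  have h : schwartzFourierInv d (schwartzFourier d g) 0 = g 0 := by
    rw [schwartzFourierInv_apply_fourier]
  rw [schwartzFourierInv_coe] at h
  simpa [fourierInv] using h

theorem integrable_temperate_mul {N : Space d → ℂ} (hN : N.HasTemperateGrowth)
    (g : 𝓢(Space d, ℂ)) : Integrable (fun ξ => N ξ * g ξ) := by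
  have := (SchwartzMap.smulLeftCLM ℂ N g).integrable (μ := volume)
  simpa [SchwartzMap.smulLeftCLM_apply hN] using this

theorem temperate_fderiv_apply {E F : Type} [NormedAddCommGroup E] [NormedSpace ℝ E]
    [NormedAddCommGroup F] [NormedSpace ℝ F] {N : E → F} (hN : N.HasTemperateGrowth)
    (m : E) : (fun ξ => fderiv ℝ N ξ m).HasTemperateGrowth := by
  have hf : ContDiff ℝ ∞ (fderiv ℝ N) := hN.1.fderiv_right (by simp)
  refine ⟨hf.clm_apply contDiff_const, fun n => ?_⟩
  obtain ⟨k, C, hC⟩ := hN.2 (n + 1)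
  refine ⟨k, ‖m‖ * C, fun x => ?_⟩
  refine (norm_iteratedFDeriv_clm_apply_const hf.contDiffAt (WithTop.coe_le_coe.2 le_top)).trans ?_
  rw [norm_iteratedFDeriv_fderiv, mul_assoc]
  gcongr
  exact hC x

/-- Multiplying the test function by a linear form amounts to differentiating the symbol. -/
theorem symbolPairing_inner_mul {N : Space d → ℂ} (hN : N.HasTemperateGrowth)
    (g : 𝓢(Space d, ℂ)) (m : Space d) :
    symbolPairing N
      (SchwartzMap.smulLeftCLM ℂ (fun x : Space d => ((inner ℝ x m : ℝ) : ℂ)) g) =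
      symbolPairing (fun ξ => Complex.I * fderiv ℝ N ξ m) g := by
  have hN' := temperate_fderiv_apply hN m
  have hIN' : (fun ξ => Complex.I * fderiv ℝ N ξ m).HasTemperateGrowth := by
    exact (Function.HasTemperateGrowth.const Complex.I).mul hN'
  rw [symbolPairing_apply hN, symbolPairing_apply hIN']
  congr 1
  set G := schwartzFourier d g
  have hG : ∀ ξ, fderiv ℝ G ξ m = (LineDeriv.lineDerivOp m G : 𝓢(Space d, ℂ)) ξ := fun ξ =>
    (SchwartzMap.lineDerivOp_apply_eq_fderiv m G ξ).symm
  have key := integral_mul_fderiv_eq_neg_fderiv_mul_of_integrable (μ := volume) (f := N)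
    (g := G) (v := m) (integrable_temperate_mul hN' G)
    (by simp only [hG]; exact integrable_temperate_mul hN _)
    (integrable_temperate_mul hN G)
    (fun x _ => (hN.1.differentiable (by simp)) x)
    (fun x _ => G.differentiableAt)
  simp only [schwartzFourier_inner_mul]
  calc ∫ ξ, N ξ * (-Complex.I * fderiv ℝ G ξ m) = -Complex.I * ∫ ξ, N ξ * fderiv ℝ G ξ m := by
        rw [← integral_const_mul]
        congr 1
        funext ξ
        ring
    _ = Complex.I * ∫ ξ, fderiv ℝ N ξ m * G ξ := by rw [key]; ring
    _ = _ := by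
        rw [← integral_const_mul]
        congr 1
        funext ξ
        ring

end FourierTransform

section InitialDatum

/-! ### The initial datum is a Schwartz function -/

variable {d : ℕ}

theorem temperate_prod {E ι : Type} [NormedAddCommGroup E] [NormedSpace ℝ E] {R : Type}
    [NormedCommRing R] [NormedAlgebra ℝ R] (s : Finset ι) {f : ι → E → R}
    (hf : ∀ i ∈ s, (f i).HasTemperateGrowth) :
    (fun x => ∏ i ∈ s, f i x).HasTemperateGrowth := by
  classical
  induction s using Finset.induction_on with
  | empty => simp
  | insert a s ha ih =>
    simp only [Finset.prod_insert ha]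
    exact (hf a (Finset.mem_insert_self a s)).mul
      (ih fun i hi => hf i (Finset.mem_insert_of_mem hi))

theorem temperate_coord (i : Fin d) : (fun x : Space d => x i).HasTemperateGrowth :=
  (EuclideanSpace.proj (𝕜 := ℝ) (ι := Fin d) i).hasTemperateGrowth

/-- Index set of the components of all tensors of degree at most `pbar`. -/
abbrev TensorIndex (d pbar : ℕ) : Type := Σ p : Fin (pbar + 1), (Fin p → Fin d)

theorem potential_eq_sum (pbar : ℕ) (lam : (p : ℕ) → (Fin p → Fin d) → ℝ) (x : Space d) :
    potential pbar lam x = ∑ a : TensorIndex d pbar, lam a.1 a.2 * ∏ j, x (a.2 j) := by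
  unfold potential tensorForm
  rw [Finset.sum_range, Fintype.sum_sigma]

theorem temperate_monomial {n : ℕ} (X : Fin n → Fin d) :
    (fun x : Space d => ∏ j, x (X j)).HasTemperateGrowth :=
  temperate_prod _ fun _ _ => temperate_coord _

theorem temperate_potential (pbar : ℕ) (lam : (p : ℕ) → (Fin p → Fin d) → ℝ) :
    (potential pbar lam).HasTemperateGrowth := by
  have : potential pbar lam = fun x : Space d =>
      ∑ a : TensorIndex d pbar, lam a.1 a.2 * ∏ j, x (a.2 j) :=
    funext (potential_eq_sum pbar lam)
  rw [this]
  exact Function.HasTemperateGrowth.sum fun a _ =>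
    (Function.HasTemperateGrowth.const _).mul (temperate_monomial a.2)

/-- The tensors `lam'` have the same leading part as `lam` and smaller components. This is the
relation between the rescaled tensors `ε^{pbar-p} λ^{(p)}`, `0 < ε ≤ 1`, and `λ`. -/
structure Dominated (pbar : ℕ) (lam' lam : (p : ℕ) → (Fin p → Fin d) → ℝ) : Prop where
  top_eq : lam' pbar = lam pbar
  abs_le : ∀ p X, |lam' p X| ≤ |lam p X|

theorem Dominated.refl (pbar : ℕ) (lam : (p : ℕ) → (Fin p → Fin d) → ℝ) :
    Dominated pbar lam lam := ⟨rfl, fun _ _ => le_rfl⟩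

theorem exists_norm_iteratedFDeriv_potential_le (pbar : ℕ)
    (lam : (p : ℕ) → (Fin p → Fin d) → ℝ) (n : ℕ) :
    ∃ (k : ℕ) (C : ℝ), 0 ≤ C ∧ ∀ lam', Dominated pbar lam' lam → ∀ i ≤ n, ∀ x,
      ‖iteratedFDeriv ℝ i (potential pbar lam') x‖ ≤ C * (1 + ‖x‖) ^ k := by
  choose k C hC0 hC using fun a : TensorIndex d pbar =>
    (temperate_monomial a.2).norm_iteratedFDeriv_le_uniform n
  refine ⟨∑ a, k a, ∑ a : TensorIndex d pbar, |lam a.1 a.2| * C a,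
    Finset.sum_nonneg fun a _ => mul_nonneg (abs_nonneg _) (hC0 a), fun lam' hlam' i hi x => ?_⟩
  have e : potential pbar lam' = fun x : Space d =>
      ∑ a : TensorIndex d pbar, lam' a.1 a.2 • ∏ j, x (a.2 j) :=
    funext (potential_eq_sum pbar lam')
  have hsm : ∀ a : TensorIndex d pbar,
      ContDiff ℝ i (fun x : Space d => ∏ j, x (a.2 j)) := fun a =>
    (temperate_monomial a.2).1.of_le (WithTop.coe_le_coe.2 le_top)
  rw [e, iteratedFDeriv_fun_sum_apply (fun a _ => ((hsm a).const_smul _).contDiffAt),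
    Finset.sum_mul]
  refine (norm_sum_le _ _).trans (Finset.sum_le_sum fun a _ => ?_)
  rw [iteratedFDeriv_const_smul_apply' (hsm a).contDiffAt, norm_smul, mul_assoc]
  have h1 : (1 : ℝ) ≤ 1 + ‖x‖ := by linarith [norm_nonneg x]
  have h2 := hC0 a
  gcongr
  · exact hlam'.abs_le _ _
  · refine (hC a i hi x).trans ?_
    gcongr
    exact Finset.single_le_sum (f := k) (fun _ _ => Nat.zero_le _) (Finset.mem_univ a)

theorem tensorForm_smul {p : ℕ} (T : (Fin p → Fin d) → ℝ) (c : ℝ) (x : Space d) :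
    tensorForm T (c • x) = c ^ p * tensorForm T x := by
  unfold tensorForm
  rw [Finset.mul_sum]
  refine Finset.sum_congr rfl fun X _ => ?_
  simp [Finset.prod_mul_distrib]
  ring

theorem abs_tensorForm_le {p : ℕ} (T : (Fin p → Fin d) → ℝ) (x : Space d) :
    |tensorForm T x| ≤ (∑ X, |T X|) * ‖x‖ ^ p := by
  unfold tensorForm
  rw [Finset.sum_mul]
  refine (Finset.abs_sum_le_sum_abs _ _).trans (Finset.sum_le_sum fun X _ => ?_)
  rw [abs_mul, Finset.abs_prod]
  gcongr
  calc ∏ j, |x (X j)| ≤ ∏ _j : Fin p, ‖x‖ := by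
        gcongr with j
        exact PiLp.norm_apply_le x (X j)
    _ = _ := by simp

theorem continuous_tensorForm {p : ℕ} (T : (Fin p → Fin d) → ℝ) :
    Continuous (tensorForm T : Space d → ℝ) := by
  unfold tensorForm
  fun_prop

theorem exists_le_tensorForm {p : ℕ} (hp : 0 < p) {T : (Fin p → Fin d) → ℝ}
    (hT : ∀ x : Space d, x ≠ 0 → 0 < tensorForm T x) :
    ∃ c > 0, ∀ x : Space d, c * ‖x‖ ^ p ≤ tensorForm T x := by
  have h0 : ∀ x : Space d, x = 0 → tensorForm T x = 0 := by
    rintro x rfl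
    have := tensorForm_smul T 0 (0 : Space d)
    rwa [zero_pow hp.ne', zero_mul, smul_zero] at this
  have hpos : ∃ c > 0, ∀ x ∈ Metric.sphere (0 : Space d) 1, c ≤ tensorForm T x := by
    rcases (Metric.sphere (0 : Space d) 1).eq_empty_or_nonempty with he | hne
    · exact ⟨1, one_pos, by simp [he]⟩
    · obtain ⟨y, hy, hmin⟩ := (isCompact_sphere (0 : Space d) 1).exists_isMinOn hne
        (continuous_tensorForm T).continuousOn
      refine ⟨tensorForm T y, hT y ?_, fun x hx => hmin hx⟩
      rintro rfl
      simp at hy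
  obtain ⟨c, hc, h⟩ := hpos
  refine ⟨c, hc, fun x => ?_⟩
  by_cases hx : x = 0
  · rw [h0 x hx, hx, norm_zero, zero_pow hp.ne', mul_zero]
  · have hn : ‖x‖ ≠ 0 := norm_ne_zero_iff.2 hx
    have h1 := h (‖x‖⁻¹ • x) (by simp [norm_smul, hn])
    rw [tensorForm_smul, inv_pow] at h1
    have h2 : 0 < ‖x‖ ^ p := by positivity
    rw [mul_comm]
    rwa [le_inv_mul_iff₀ h2] at h1

theorem exists_sub_le_pow {p : ℕ} (hp : 2 ≤ p) {c : ℝ} (hc : 0 < c) {A : ℝ} (hA : 0 ≤ A) :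
    ∃ C, ∀ r : ℝ, 0 ≤ r → r - C ≤ c * r ^ p - A * (1 + r) ^ (p - 1) := by
  set R : ℝ := max 1 ((A * 2 ^ (p - 1) + 1) / c) with hR
  refine ⟨R + A * (1 + R) ^ (p - 1), fun r hr => ?_⟩
  have hR0 : 0 ≤ R := zero_le_one.trans (le_max_left _ _)
  rcases le_total r R with h | h
  · have h1 : A * (1 + r) ^ (p - 1) ≤ A * (1 + R) ^ (p - 1) := by gcongr
    have h2 : 0 ≤ c * r ^ p := by positivity
    linarith
  · have hr1 : 1 ≤ r := (le_max_left _ _).trans h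
    have h1 : (A * 2 ^ (p - 1) + 1) ≤ c * r := by
      have := (le_max_right _ _).trans h
      rwa [div_le_iff₀' hc] at this
    have h2 : A * (1 + r) ^ (p - 1) ≤ A * (2 ^ (p - 1) * r ^ (p - 1)) := by
      rw [← mul_pow]
      gcongr
      linarith
    have h3 : r ≤ r ^ (p - 1) := le_self_pow₀ hr1 (by omega)
    have h4 : c * r ^ p = (c * r) * r ^ (p - 1) := by
      obtain ⟨q, rfl⟩ : ∃ q, p = q + 1 := ⟨p - 1, by omega⟩
      simp [pow_succ]
      ring
    have h5 : (A * 2 ^ (p - 1) + 1) * r ^ (p - 1) ≤ (c * r) * r ^ (p - 1) := by gcongr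
    have h6 : 0 ≤ A * (1 + R) ^ (p - 1) := by positivity
    nlinarith

/-- The potential grows at least linearly, uniformly for all dominated tensors: its leading part of
degree `pbar ≥ 2` beats the parts of lower degree. -/
theorem exists_norm_sub_le_potential {pbar : ℕ} (hp : 2 ≤ pbar)
    {lam : (p : ℕ) → (Fin p → Fin d) → ℝ}
    (hlam : ∀ φ : Space d, φ ≠ 0 → 0 < tensorForm (lam pbar) φ) :
    ∃ C, ∀ lam', Dominated pbar lam' lam → ∀ x, ‖x‖ - C ≤ potential pbar lam' x := by
  obtain ⟨c, hc, htop⟩ := exists_le_tensorForm (by omega) hlam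
  set A := ∑ p ∈ Finset.range pbar, ∑ X, |lam p X| with hA
  obtain ⟨C, hC⟩ := exists_sub_le_pow hp hc (A := A) (by positivity)
  refine ⟨C, fun lam' h x => (hC ‖x‖ (norm_nonneg x)).trans ?_⟩
  unfold potential
  rw [Finset.sum_range_succ, h.top_eq]
  have h1 : |∑ p ∈ Finset.range pbar, tensorForm (lam' p) x| ≤ A * (1 + ‖x‖) ^ (pbar - 1) := by
    rw [hA, Finset.sum_mul]
    refine (Finset.abs_sum_le_sum_abs _ _).trans (Finset.sum_le_sum fun p hp => ?_)
    refine (abs_tensorForm_le _ _).trans ?_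
    have h2 : ‖x‖ ^ p ≤ (1 + ‖x‖) ^ (pbar - 1) :=
      calc ‖x‖ ^ p ≤ (1 + ‖x‖) ^ p := by gcongr; linarith
        _ ≤ _ := pow_le_pow_right₀ (by linarith [norm_nonneg x])
          (by have := Finset.mem_range.1 hp; omega)
    exact mul_le_mul (Finset.sum_le_sum fun X _ => h.abs_le p X) h2 (by positivity)
      (Finset.sum_nonneg fun X _ => abs_nonneg _)
  have := neg_abs_le (∑ p ∈ Finset.range pbar, tensorForm (lam' p) x)
  linarith [htop x]

/-- The Schwartz seminorms of `e^{-V'}` are bounded uniformly for all dominated tensors. -/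
theorem exists_norm_iteratedFDeriv_gibbs_le {pbar : ℕ} (hp : 2 ≤ pbar)
    {lam : (p : ℕ) → (Fin p → Fin d) → ℝ}
    (hlam : ∀ φ : Space d, φ ≠ 0 → 0 < tensorForm (lam pbar) φ) (k n : ℕ) :
    ∃ C : ℝ, ∀ lam', Dominated pbar lam' lam → ∀ x, ‖x‖ ^ k *
      ‖iteratedFDeriv ℝ n (fun y => Complex.exp (-(potential pbar lam' y : ℂ))) x‖ ≤ C := by
  obtain ⟨c, hc⟩ := exists_norm_sub_le_potential hp hlam
  obtain ⟨K, B, hB0, hB⟩ := exists_norm_iteratedFDeriv_potential_le pbar lam n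
  set D := max 1 B with hD
  refine ⟨n.factorial * D ^ n * ((k + K * n).factorial * Real.exp (1 + c)), fun lam' h x => ?_⟩
  have h1 : (1 : ℝ) ≤ 1 + ‖x‖ := by linarith [norm_nonneg x]
  have hV := (temperate_potential pbar lam').1
  have hVc : ContDiff ℝ ∞ (fun y => (Complex.ofRealLI : ℝ → ℂ) (potential pbar lam' y)) :=
    Complex.ofRealLI.contDiff.comp hV
  have key := norm_iteratedFDeriv_comp_le (𝕜 := ℝ) (g := Complex.exp)
    (f := fun y => -(potential pbar lam' y : ℂ)) (n := n) (N := ((⊤ : ℕ∞) : ℕ∞ω))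
    Complex.contDiff_exp hVc.neg (WithTop.coe_le_coe.2 le_top) x
    (C := Real.exp (-potential pbar lam' x)) (D := D * (1 + ‖x‖) ^ K)
    (fun i _ => by
      rw [norm_iteratedFDeriv_cexp]
      simp)
    (fun i hi hin => by
      have e : (fun y => -(potential pbar lam' y : ℂ)) =
          -(Complex.ofRealLI ∘ (potential pbar lam')) := rfl
      rw [e, iteratedFDeriv_neg_apply, norm_neg,
        LinearIsometry.norm_iteratedFDeriv_comp_left _
          (hV.of_le (WithTop.coe_le_coe.2 le_top)).contDiffAt le_rfl]
      have : (1 : ℝ) ≤ D * (1 + ‖x‖) ^ K :=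
        one_le_mul_of_one_le_of_one_le (le_max_left _ _) (one_le_pow₀ h1)
      refine (hB lam' h i hin x).trans (le_trans ?_ (le_self_pow₀ this (by omega)))
      gcongr
      exact le_max_right _ _)
  have hexp : Real.exp (-potential pbar lam' x) ≤ Real.exp (c - ‖x‖) :=
    Real.exp_le_exp.2 (by linarith [hc lam' h x])
  have hpow : (1 + ‖x‖) ^ (k + K * n) ≤ (k + K * n).factorial * Real.exp (1 + ‖x‖) := by
    have := Real.pow_div_factorial_le_exp (1 + ‖x‖) (by linarith) (k + K * n)
    rwa [div_le_iff₀' (by positivity)] at this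
  calc _ ≤ (1 + ‖x‖) ^ k * (n.factorial * Real.exp (-potential pbar lam' x) *
        (D * (1 + ‖x‖) ^ K) ^ n) := by
        gcongr
        · linarith
        · exact key
    _ = n.factorial * D ^ n * ((1 + ‖x‖) ^ (k + K * n) * Real.exp (-potential pbar lam' x)) := by
        rw [mul_pow, pow_add, ← pow_mul]
        ring
    _ ≤ n.factorial * D ^ n * (((k + K * n).factorial * Real.exp (1 + ‖x‖)) *
          Real.exp (c - ‖x‖)) := by gcongr
    _ = _ := by
        rw [mul_assoc _ (Real.exp (1 + ‖x‖)), ← Real.exp_add]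
        rw [show 1 + ‖x‖ + (c - ‖x‖) = 1 + c by ring]

/-- The Schwartz function `e^{-V}`. -/
noncomputable def gibbs {pbar : ℕ} (hp : 2 ≤ pbar) {lam : (p : ℕ) → (Fin p → Fin d) → ℝ}
    (hlam : ∀ φ : Space d, φ ≠ 0 → 0 < tensorForm (lam pbar) φ) : 𝓢(Space d, ℂ) where
  toFun y := Complex.exp (-(potential pbar lam y : ℂ))
  smooth' := Complex.contDiff_exp.comp
    (Complex.ofRealCLM.contDiff.comp (temperate_potential pbar lam).1).neg
  decay' k n := by
    obtain ⟨C, hC⟩ := exists_norm_iteratedFDeriv_gibbs_le hp hlam k n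
    exact ⟨C, hC lam (Dominated.refl pbar lam)⟩

theorem gibbs_apply {pbar : ℕ} (hp : 2 ≤ pbar) {lam : (p : ℕ) → (Fin p → Fin d) → ℝ}
    (hlam : ∀ φ : Space d, φ ≠ 0 → 0 < tensorForm (lam pbar) φ) (x : Space d) :
    gibbs hp hlam x = Complex.exp (-(potential pbar lam x : ℂ)) := rfl

theorem tensorForm_const_mul {p : ℕ} (c : ℝ) (T : (Fin p → Fin d) → ℝ) (x : Space d) :
    tensorForm (fun X => c * T X) x = c * tensorForm T x := by
  unfold tensorForm
  rw [Finset.mul_sum]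
  exact Finset.sum_congr rfl fun X _ => by ring

theorem potential_const_mul (pbar : ℕ) (c : ℝ) (lam : (p : ℕ) → (Fin p → Fin d) → ℝ)
    (x : Space d) : potential pbar (fun p X => c * lam p X) x = c * potential pbar lam x := by
  unfold potential
  rw [Finset.mul_sum]
  exact Finset.sum_congr rfl fun p _ => tensorForm_const_mul c _ x

open Classical in
/-- The initial datum `f_β` as a Schwartz function; zero if `f_β` is not a Schwartz function. -/
noncomputable def schwartzDatum (pbar : ℕ) (lam : (p : ℕ) → (Fin p → Fin d) → ℝ) (β : ℝ) :
    𝓢(Space d, ℂ) :=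
  if h : ∃ G : 𝓢(Space d, ℂ), ∀ x, G x = initialDatum pbar lam β x then h.choose else 0

theorem schwartzDatum_apply {pbar : ℕ} (hp : 2 ≤ pbar) {lam : (p : ℕ) → (Fin p → Fin d) → ℝ}
    (hlam : ∀ φ : Space d, φ ≠ 0 → 0 < tensorForm (lam pbar) φ) {β : ℝ} (hβ : 0 < β)
    (x : Space d) : schwartzDatum pbar lam β x = initialDatum pbar lam β x := by
  have hex : ∃ G : 𝓢(Space d, ℂ), ∀ x, G x = initialDatum pbar lam β x := by
    refine ⟨gibbs hp (lam := fun p X => β * lam p X) fun φ hφ => ?_, fun x => ?_⟩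
    · rw [tensorForm_const_mul]
      exact mul_pos hβ (hlam φ hφ)
    · rw [gibbs_apply, potential_const_mul]
      simp [initialDatum]
  rw [schwartzDatum, dif_pos hex]
  exact hex.choose_spec x

theorem isExpMultiplier_neg_potential {pbar : ℕ} (hp : 2 ≤ pbar)
    {lam : (p : ℕ) → (Fin p → Fin d) → ℝ}
    (hlam : ∀ φ : Space d, φ ≠ 0 → 0 < tensorForm (lam pbar) φ) :
    IsExpMultiplier (fun x : Space d => -(potential pbar lam x : ℂ)) where
  temperate := (Function.HasTemperateGrowth.comp Function.Complex.hasTemperateGrowth_ofReal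
    (temperate_potential pbar lam)).neg
  exp_le := by
    obtain ⟨C, hC⟩ := exists_norm_sub_le_potential hp hlam
    refine ⟨0, Real.exp C, fun x => ?_⟩
    have := hC lam (Dominated.refl pbar lam) x
    simp only [pow_zero, mul_one, Complex.neg_re, Complex.ofReal_re]
    exact Real.exp_le_exp.2 (by linarith [norm_nonneg x])

end InitialDatum

section CauchyProblem

/-! ### Solution of the Cauchy problem -/

variable {d : ℕ} {Ψ : (Fin d → ℂ) → ℂ}

theorem IsAdmissibleSymbol.isExpMultiplier (hΨ : IsAdmissibleSymbol Ψ) :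
    IsExpMultiplier (axisSymbol Ψ) where
  temperate := ⟨hΨ.smooth, hΨ.deriv_bound⟩
  exp_le := by
    obtain ⟨c, hc⟩ := hΨ.re_le_log
    obtain ⟨N, hN⟩ := exists_nat_ge c
    refine ⟨N, 1, fun x => ?_⟩
    have h1 : (1 : ℝ) ≤ 1 + ‖x‖ := by linarith [norm_nonneg x]
    calc Real.exp (axisSymbol Ψ x).re ≤ Real.exp (N * Real.log (1 + ‖x‖)) := by
          refine Real.exp_le_exp.2 ((hc x).trans ?_)
          have := Real.log_nonneg h1
          gcongr
      _ = 1 * (1 + ‖x‖) ^ N := by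
          rw [Real.exp_nat_mul, Real.exp_log (by linarith), one_mul]

/-- The solution of the Cauchy problem, written on the Fourier side. -/
noncomputable def cauchySolution (Ψ : (Fin d → ℂ) → ℂ) (f : 𝓢(Space d, ℂ)) (t : ℝ) :
    𝓢(Space d, ℂ) :=
  schwartzFourierInv d (expMul (axisSymbol Ψ) t (schwartzFourier d f))

theorem fourierInv_comp_sub_left (f : Space d → ℂ) (φ ξ : Space d) :
    fourierInv (fun x => f (φ - x)) ξ =
      ((2 * Real.pi : ℝ) : ℂ)⁻¹ ^ d *
        (Complex.exp (-Complex.I * (inner ℝ ξ φ : ℝ)) * fourier f ξ) := by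
  unfold fourierInv fourier
  congr 1
  rw [← integral_sub_left_eq_self _ volume φ, ← integral_const_mul]
  refine integral_congr_ae (Eventually.of_forall fun x => ?_)
  simp only [sub_sub_cancel]
  rw [mul_left_comm, ← Complex.exp_add, real_inner_comm, inner_sub_right]
  congr 2
  push_cast
  ring

theorem nuConv_eq_integral (Ψ : (Fin d → ℂ) → ℂ) (t : ℝ) (f : Space d → ℂ) (φ : Space d) :
    nuConv Ψ t f φ = ((2 * Real.pi : ℝ) : ℂ)⁻¹ ^ d *
      ∫ ξ, Complex.exp (t * axisSymbol Ψ ξ + -Complex.I * (inner ℝ ξ φ : ℝ)) * fourier f ξ := by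
  unfold nuConv nuPairing
  rw [← integral_const_mul]
  refine integral_congr_ae (Eventually.of_forall fun ξ => ?_)
  simp only [fourierInv_comp_sub_left, Complex.exp_add]
  ring

theorem cauchySolution_apply (hΨ : IsAdmissibleSymbol Ψ) (f : 𝓢(Space d, ℂ)) {t : ℝ}
    (ht : 0 ≤ t) (φ : Space d) : cauchySolution Ψ f t φ = nuConv Ψ t f φ := by
  rw [nuConv_eq_integral, cauchySolution, schwartzFourierInv_coe]
  unfold fourierInv
  congr 1
  refine integral_congr_ae (Eventually.of_forall fun ξ => ?_)
  simp only [hΨ.isExpMultiplier.expMul_apply ht, schwartzFourier_coe, Complex.exp_add]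
  ring

/-- `Ψ(∇)` on Schwartz functions. -/
noncomputable def schwartzPseudoDiff (Ψ : (Fin d → ℂ) → ℂ) (g : 𝓢(Space d, ℂ)) :
    𝓢(Space d, ℂ) :=
  schwartzFourierInv d (SchwartzMap.smulLeftCLM ℂ (axisSymbol Ψ) (schwartzFourier d g))

theorem schwartzPseudoDiff_coe (hΨ : IsAdmissibleSymbol Ψ) (g : 𝓢(Space d, ℂ)) :
    (schwartzPseudoDiff Ψ g : Space d → ℂ) = pseudoDiff Ψ g := by
  rw [schwartzPseudoDiff, schwartzFourierInv_coe,
    SchwartzMap.smulLeftCLM_apply hΨ.isExpMultiplier.temperate, schwartzFourier_coe]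
  rfl

theorem isCauchySolution_of_eq (hΨ : IsAdmissibleSymbol Ψ) (f : 𝓢(Space d, ℂ))
    {u : ℝ → Space d → ℂ} (hu : ∀ t : ℝ, 0 ≤ t → ∀ φ, u t φ = nuConv Ψ t f φ) :
    IsCauchySolution Ψ f u := by
  have hE := hΨ.isExpMultiplier
  have hcoe : ∀ t : ℝ, 0 ≤ t → u t = cauchySolution Ψ f t := fun t ht => by
    funext φ
    rw [hu t ht, cauchySolution_apply hΨ f ht]
  refine ⟨cauchySolution Ψ f, fun t ht φ => by rw [hcoe t ht], ?_, ?_, fun t ht => ?_⟩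
  · rw [hcoe 0 le_rfl]
    have : expMul (axisSymbol Ψ) 0 (schwartzFourier d f) = schwartzFourier d f := by
      ext ξ
      simp [hE.expMul_apply le_rfl]
    rw [cauchySolution, this, schwartzFourierInv_apply_fourier]
  · have h := ((schwartzFourierInv d).continuous.tendsto _).comp
      (hE.tendsto_expMul (schwartzFourier d f) le_rfl)
    refine h.mono_left (nhdsWithin_mono _ fun s hs => ?_)
    exact ⟨Set.mem_Ici.2 (Set.mem_Ioi.1 hs).le, ne_of_gt hs⟩
  · refine ⟨schwartzPseudoDiff Ψ (cauchySolution Ψ f t), fun φ => ?_, ?_⟩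
    · rw [schwartzPseudoDiff_coe hΨ, hcoe t ht.le]
    · have h := ((schwartzFourierInv d).continuous.tendsto _).comp
        (hE.tendsto_slope_expMul (schwartzFourier d f) ht.le)
      have hmem : 𝓝[≠] t ≤ 𝓝[Set.Ici 0 \ {t}] t := by
        refine nhdsWithin_le_iff.2 ?_
        filter_upwards [self_mem_nhdsWithin, nhdsWithin_le_nhds (Ioi_mem_nhds ht)] with s hs hs'
        exact ⟨Set.mem_Ici.2 (Set.mem_Ioi.1 hs').le, hs⟩
      have e : schwartzFourierInv d (expMul (axisSymbol Ψ) t (SchwartzMap.smulLeftCLM ℂ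
          (axisSymbol Ψ) (schwartzFourier d f))) =
          schwartzPseudoDiff Ψ (cauchySolution Ψ f t) := by
        rw [schwartzPseudoDiff, cauchySolution, schwartzFourier_apply_inv]
        congr 1
        ext ξ
        simp only [hE.expMul_apply ht.le, SchwartzMap.smulLeftCLM_apply_apply hE.temperate,
          smul_eq_mul]
        ring
      rw [e] at h
      refine (h.mono_left hmem).congr fun s => ?_
      simp only [Function.comp_apply, cauchySolution]
      rw [(schwartzFourierInv d).map_smul_of_tower, map_sub]

/-- Uniqueness: on the Fourier side the equation is the ordinary differential equation `b' = ψ b` at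
every frequency, so that `e^{-tψ} b` is constant. -/
theorem eq_nuConv_of_isCauchySolution (hΨ : IsAdmissibleSymbol Ψ) (f : 𝓢(Space d, ℂ))
    {u : ℝ → Space d → ℂ} (hu : IsCauchySolution Ψ f u) {t : ℝ} (ht : 0 ≤ t) (φ : Space d) :
    u t φ = nuConv Ψ t f φ := by
  have hE := hΨ.isExpMultiplier
  obtain ⟨U, hUu, hu0, hU0, hUd⟩ := hu
  have hcoe : ∀ t : ℝ, 0 ≤ t → (U t : Space d → ℂ) = u t := fun t ht => funext (hUu t ht)
  have hUzero : U 0 = f := by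
    ext x
    rw [hUu 0 le_rfl, hu0]
  suffices h : U t = cauchySolution Ψ f t by
    rw [← hUu t ht, h, cauchySolution_apply hΨ f ht]
  suffices h : schwartzFourier d (U t) = expMul (axisSymbol Ψ) t (schwartzFourier d f) by
    rw [cauchySolution, ← h, schwartzFourierInv_apply_fourier]
  ext ξ
  rw [hE.expMul_apply ht]
  -- the value at `ξ` as a continuous linear functional of the test function
  set ev : 𝓢(Space d, ℂ) →L[ℂ] ℂ :=
    ((BoundedContinuousFunction.evalCLM ℂ ξ).comp
      (SchwartzMap.toBoundedContinuousFunctionCLM ℂ (Space d) ℂ)).comp (schwartzFourier d) with hev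
  have hev' : ∀ g, ev g = schwartzFourier d g ξ := fun g => rfl
  set ψ := axisSymbol Ψ ξ with hψ
  have hderiv : ∀ s : ℝ, 0 < s → HasDerivAt (fun r => ev (U r)) (ψ * ev (U s)) s := by
    intro s hs
    obtain ⟨U', hU', hlim⟩ := hUd s hs
    have e : U' = schwartzPseudoDiff Ψ (U s) := by
      ext x
      rw [hU', schwartzPseudoDiff_coe hΨ, hcoe s hs.le]
    have h := (ev.continuous.tendsto U').comp hlim
    have e2 : ev U' = ψ * ev (U s) := by
      rw [hev', e, schwartzPseudoDiff, schwartzFourier_apply_inv,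
        SchwartzMap.smulLeftCLM_apply_apply hE.temperate, hev', smul_eq_mul]
    rw [e2] at h
    rw [hasDerivAt_iff_tendsto_slope]
    refine h.congr fun r => ?_
    rw [Function.comp_apply, slope_def_module, ← Complex.coe_smul, map_smul, map_sub,
      ← Complex.coe_smul]
  set b : ℝ → ℂ := fun s => Complex.exp (-(s * ψ)) * ev (U s) with hb
  have hexp : ∀ s : ℝ, HasDerivAt (fun r : ℝ => Complex.exp (-(r * ψ)))
      (Complex.exp (-(s * ψ)) * -(1 * ψ)) s := fun s =>
    (((Complex.ofRealCLM.hasDerivAt (x := s)).mul_const ψ).neg).cexp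
  have hbd : ∀ s : ℝ, 0 < s → HasDerivAt b 0 s := by
    intro s hs
    have := (hexp s).mul (hderiv s hs)
    refine this.congr_deriv ?_
    ring
  have hconst : ∀ r ∈ Set.Ioi (0 : ℝ), ∀ s ∈ Set.Ioi (0 : ℝ), b r = b s := fun r hr s hs =>
    isOpen_Ioi.is_const_of_deriv_eq_zero (convex_Ioi 0).isPreconnected
      (fun x hx => (hbd x hx).differentiableAt.differentiableWithinAt)
      (fun x hx => (hbd x hx).deriv) hr hs
  have hb0 : Tendsto b (𝓝[>] 0) (𝓝 (b 0)) := by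
    refine Tendsto.mul ?_ ((ev.continuous.tendsto _).comp hU0)
    exact ((hexp 0).continuousAt.tendsto).mono_left nhdsWithin_le_nhds
  have hbt : b t = b 0 := by
    rcases ht.eq_or_lt with rfl | ht
    · rfl
    · refine tendsto_nhds_unique (f := b) (l := 𝓝[>] 0) ?_ hb0
      refine tendsto_const_nhds.congr' ?_
      filter_upwards [self_mem_nhdsWithin] with s hs
      exact hconst t ht s hs
  simp only [hb, Complex.ofReal_zero, zero_mul, neg_zero, Complex.exp_zero, one_mul, hUzero] at hbt
  rw [hev', hev', Complex.exp_neg, inv_mul_eq_iff_eq_mul₀ (Complex.exp_ne_zero _)] at hbt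
  exact hbt

theorem isCauchySolution_iff (hΨ : IsAdmissibleSymbol Ψ) (f : 𝓢(Space d, ℂ))
    (u : ℝ → Space d → ℂ) :
    IsCauchySolution Ψ f u ↔ ∀ t : ℝ, 0 ≤ t → ∀ φ, u t φ = nuConv Ψ t f φ :=
  ⟨fun h _ ht φ => eq_nuConv_of_isCauchySolution hΨ f h ht φ, isCauchySolution_of_eq hΨ f⟩

end CauchyProblem

section SmallCoupling

/-! ### The limit of small coupling -/

variable {d : ℕ}

theorem IsExpMultiplier.hasDerivAt_apply_expMul {E : Type} [NormedAddCommGroup E]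
    [NormedSpace ℝ E] {ψ : E → ℂ} (h : IsExpMultiplier ψ) (L : 𝓢(E, ℂ) →L[ℂ] ℂ)
    (g : 𝓢(E, ℂ)) {t : ℝ} (ht : 0 < t) :
    HasDerivAt (fun s => L (expMul ψ s g))
      (L (expMul ψ t (SchwartzMap.smulLeftCLM ℂ ψ g))) t := by
  rw [hasDerivAt_iff_tendsto_slope]
  have hmem : 𝓝[≠] t ≤ 𝓝[Set.Ici 0 \ {t}] t := by
    refine nhdsWithin_le_iff.2 ?_
    filter_upwards [self_mem_nhdsWithin, nhdsWithin_le_nhds (Ioi_mem_nhds ht)] with s hs hs'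
    exact ⟨Set.mem_Ici.2 (Set.mem_Ioi.1 hs').le, hs⟩
  refine (((L.continuous.tendsto _).comp (h.tendsto_slope_expMul g ht.le)).mono_left hmem).congr
    fun s => ?_
  rw [Function.comp_apply, slope_def_module, L.map_smul_of_tower, map_sub]

/-- Derivatives of `β ↦ f_β` in the Schwartz topology, tested with a functional. Since only
`e^{-sV}` with `s ≥ 0` is a multiplier of the Schwartz space and differentiability at `s = 0` is
one-sided, `f_s` is written as `e^{-(s - β/2)V} f_{β/2}`. -/
theorem hasDerivAt_apply_schwartzDatum {pbar : ℕ} (hp : 2 ≤ pbar)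
    {lam : (p : ℕ) → (Fin p → Fin d) → ℝ}
    (hlam : ∀ φ : Space d, φ ≠ 0 → 0 < tensorForm (lam pbar) φ) (L : 𝓢(Space d, ℂ) →L[ℂ] ℂ)
    {β : ℝ} (hβ : 0 < β) :
    HasDerivAt (fun s => L (schwartzDatum pbar lam s))
      (L (SchwartzMap.smulLeftCLM ℂ (fun x : Space d => -(potential pbar lam x : ℂ))
        (schwartzDatum pbar lam β))) β := by
  have hV := isExpMultiplier_neg_potential hp hlam
  set ψ : Space d → ℂ := fun x => -(potential pbar lam x : ℂ) with hψ
  have hβ2 : 0 < β / 2 := half_pos hβ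
  have hs : ∀ s, β / 2 ≤ s → expMul ψ (s - β / 2) (schwartzDatum pbar lam (β / 2)) =
      schwartzDatum pbar lam s := by
    intro s hs
    ext x
    rw [hV.expMul_apply (sub_nonneg.2 hs), schwartzDatum_apply hp hlam hβ2,
      schwartzDatum_apply hp hlam (hβ2.trans_le hs)]
    simp only [initialDatum, hψ]
    push_cast
    rw [← Complex.exp_add]
    congr 1
    ring
  have h1 : HasDerivAt (fun s => L (expMul ψ s (schwartzDatum pbar lam (β / 2)))) _ (β - β / 2) :=
    hV.hasDerivAt_apply_expMul L (schwartzDatum pbar lam (β / 2)) (t := β - β / 2) (by linarith)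
  have h2 := HasDerivAt.comp_sub_const β (β / 2) h1
  have e : expMul ψ (β - β / 2) (SchwartzMap.smulLeftCLM ℂ ψ (schwartzDatum pbar lam (β / 2))) =
      SchwartzMap.smulLeftCLM ℂ ψ (schwartzDatum pbar lam β) := by
    rw [← hs β (by linarith)]
    ext x
    rw [hV.expMul_apply (by linarith), SchwartzMap.smulLeftCLM_apply_apply hV.temperate,
      SchwartzMap.smulLeftCLM_apply_apply hV.temperate, hV.expMul_apply (by linarith)]
    simp only [smul_eq_mul]
    ring
  rw [e] at h2
  refine h2.congr_of_eventuallyEq ?_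
  filter_upwards [Ioi_mem_nhds (show β / 2 < β by linarith)] with s hs'
  rw [hs s (Set.mem_Ioi.1 hs').le]

theorem symbolPairing_dilation {N : Space d → ℂ} (hN : N.HasTemperateGrowth)
    (g g' : 𝓢(Space d, ℂ)) {ε : ℝ} (hε : 0 < ε) (hg : ∀ x, g x = g' (ε • x)) :
    symbolPairing N g = symbolPairing (fun η => N (ε • η)) g' := by
  have hNε : (fun η => N (ε • η)).HasTemperateGrowth := by
    have : (fun η : Space d => ε • η).HasTemperateGrowth := by fun_prop
    exact hN.comp this
  rw [symbolPairing_apply hN, symbolPairing_apply hNε]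
  congr 1
  have h1 : ∀ ξ : Space d, fourier g ξ = ((ε ^ d)⁻¹ : ℝ) * fourier g' (ε⁻¹ • ξ) := by
    intro ξ
    have := Measure.integral_comp_smul (volume : Measure (Space d))
      (fun y => g' y * Complex.exp (Complex.I * (inner ℝ (ε⁻¹ • ξ) y : ℝ))) ε
    rw [finrank_euclideanSpace_fin, abs_of_pos (by positivity), Complex.real_smul] at this
    unfold fourier
    rw [← this]
    refine integral_congr_ae (Eventually.of_forall fun x => ?_)
    simp only [hg, inner_smul_left, inner_smul_right]
    congr 3
    simp [hε.ne']
  have h2 := Measure.integral_comp_smul (volume : Measure (Space d))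
    (fun η => N (ε • η) * schwartzFourier d g' η) ε⁻¹
  rw [finrank_euclideanSpace_fin, abs_of_pos (by positivity), Complex.real_smul, inv_pow,
    inv_inv] at h2
  have hεd : ((ε ^ d : ℝ) : ℂ) ≠ 0 := by exact_mod_cast (pow_pos hε d).ne'
  calc ∫ ξ, N ξ * schwartzFourier d g ξ =
      ((ε ^ d : ℝ) : ℂ)⁻¹ * ∫ ξ, N (ε • ε⁻¹ • ξ) * schwartzFourier d g' (ε⁻¹ • ξ) := by
        rw [← integral_const_mul]
        refine integral_congr_ae (Eventually.of_forall fun ξ => ?_)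
        simp only [schwartzFourier_coe, h1, smul_smul, mul_inv_cancel₀ hε.ne', one_smul]
        push_cast
        ring
    _ = _ := by rw [h2, ← mul_assoc, inv_mul_cancel₀ hεd, one_mul]

/-- The tensors of the rescaled potential `y ↦ ε^{pbar} V(y / ε)`. -/
def rescaledTensor (pbar : ℕ) (lam : (p : ℕ) → (Fin p → Fin d) → ℝ) (ε : ℝ) :
    (p : ℕ) → (Fin p → Fin d) → ℝ :=
  fun p X => ε ^ (pbar - p) * lam p X

theorem rescaledTensor_dominated (pbar : ℕ) (lam : (p : ℕ) → (Fin p → Fin d) → ℝ) {ε : ℝ}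
    (h0 : 0 ≤ ε) (h1 : ε ≤ 1) : Dominated pbar (rescaledTensor pbar lam ε) lam where
  top_eq := by
    funext X
    simp [rescaledTensor]
  abs_le p X := by
    rw [rescaledTensor, abs_mul, abs_of_nonneg (pow_nonneg h0 _)]
    exact mul_le_of_le_one_left (abs_nonneg _) (pow_le_one₀ h0 h1)

theorem potential_rescaledTensor (pbar : ℕ) (lam : (p : ℕ) → (Fin p → Fin d) → ℝ) (ε : ℝ)
    (x : Space d) : potential pbar (rescaledTensor pbar lam ε) (ε • x) =
      ε ^ pbar * potential pbar lam x := by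
  unfold potential
  rw [Finset.mul_sum]
  refine Finset.sum_congr rfl fun p hp => ?_
  have hp' : p ≤ pbar := by
    have := Finset.mem_range.1 hp
    omega
  unfold rescaledTensor
  rw [tensorForm_const_mul, tensorForm_smul, ← mul_assoc, ← pow_add, Nat.sub_add_cancel hp']

/-- The weight `(1 + ‖η‖²)^k`. -/
noncomputable def polyWeight (d k : ℕ) (η : Space d) : ℂ := (((1 + ‖η‖ ^ 2) ^ k : ℝ) : ℂ)

theorem temperate_polyWeight (d k : ℕ) : (polyWeight d k).HasTemperateGrowth := by
  have : (fun η : Space d => (1 + ‖η‖ ^ 2) ^ k).HasTemperateGrowth := by fun_prop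
  exact Function.HasTemperateGrowth.comp Function.Complex.hasTemperateGrowth_ofReal this

/-- The Fourier transforms of `e^{-V'}` have bounded moments, uniformly for all dominated tensors:
the moment is a continuous seminorm of `e^{-V'}`. -/
theorem exists_integral_fourier_gibbs_le {pbar : ℕ} (hp : 2 ≤ pbar)
    {lam : (p : ℕ) → (Fin p → Fin d) → ℝ}
    (hlam : ∀ φ : Space d, φ ≠ 0 → 0 < tensorForm (lam pbar) φ) (k : ℕ) :
    ∃ B : ℝ, ∀ lam', Dominated pbar lam' lam →
      ∀ h' : (∀ φ : Space d, φ ≠ 0 → 0 < tensorForm (lam' pbar) φ),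
      ∫ η, ‖polyWeight d k η * schwartzFourier d (gibbs hp h') η‖ ≤ B := by
  choose C hC using exists_norm_iteratedFDeriv_gibbs_le hp hlam
  set L : 𝓢(Space d, ℂ) →L[ℂ] Lp ℂ 1 (volume : Measure (Space d)) :=
    (SchwartzMap.toLpCLM ℂ ℂ 1 volume).comp
      ((SchwartzMap.smulLeftCLM ℂ (polyWeight d k)).comp (schwartzFourier d)) with hL
  set q : Seminorm ℂ 𝓢(Space d, ℂ) := (normSeminorm ℂ _).comp L.toLinearMap with hq
  have hqc : Continuous q := continuous_norm.comp L.continuous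
  obtain ⟨s, A, -, hA⟩ := Seminorm.bound_of_continuous (schwartz_withSeminorms ℂ (Space d) ℂ) q hqc
  refine ⟨A * ∑ m ∈ s, |C m.1 m.2|, fun lam' hd h' => ?_⟩
  have h1 : q (gibbs hp h') = ∫ η, ‖polyWeight d k η * schwartzFourier d (gibbs hp h') η‖ := by
    change ‖SchwartzMap.toLp _ 1 volume‖ = _
    rw [SchwartzMap.norm_toLp_one]
    refine integral_congr_ae (Eventually.of_forall fun η => ?_)
    simp [SchwartzMap.smulLeftCLM_apply_apply (temperate_polyWeight d k)]
  rw [← h1]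
  refine (hA _).trans ?_
  have h2 : (s.sup (schwartzSeminormFamily ℂ (Space d) ℂ)) (gibbs hp h') ≤
      ∑ m ∈ s, |C m.1 m.2| := by
    refine Seminorm.finset_sup_apply_le (by positivity) fun m hm => ?_
    refine le_trans ?_ (Finset.single_le_sum (f := fun m : ℕ × ℕ => |C m.1 m.2|)
      (fun _ _ => abs_nonneg _) hm)
    exact SchwartzMap.seminorm_le_bound ℂ m.1 m.2 _ (abs_nonneg _) fun x =>
      (hC m.1 m.2 lam' hd x).trans (le_abs_self _)
  change (A : ℝ) * _ ≤ _
  exact mul_le_mul_of_nonneg_left h2 A.2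

theorem exists_norm_sub_zero_le {N : Space d → ℂ} (hN : N.HasTemperateGrowth) :
    ∃ (k : ℕ) (C : ℝ), 0 ≤ C ∧ ∀ (ε : ℝ), 0 < ε → ε ≤ 1 → ∀ η,
      ‖N (ε • η) - N 0‖ ≤ ε * (C * (1 + ‖η‖ ^ 2) ^ k) := by
  obtain ⟨k, C, hC0, hC⟩ := hN.norm_iteratedFDeriv_le_uniform 1
  refine ⟨k + 1, C * 2 ^ (k + 1), by positivity, fun ε h0 h1 η => ?_⟩
  have hn := norm_nonneg η
  have hεn : ‖ε • η‖ = ε * ‖η‖ := by rw [norm_smul, Real.norm_of_nonneg h0.le]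
  have hle : ε * ‖η‖ ≤ ‖η‖ := mul_le_of_le_one_left hn h1
  have hmv := (convex_closedBall (0 : Space d) ‖ε • η‖).norm_image_sub_le_of_norm_fderiv_le
    (𝕜 := ℝ) (f := N) (C := C * (1 + ‖η‖) ^ k)
    (fun x _ => (hN.1.differentiable (by simp)) x)
    (fun x hx => by
      rw [← norm_iteratedFDeriv_one]
      refine (hC 1 le_rfl x).trans ?_
      have : ‖x‖ ≤ ‖η‖ := by
        rw [mem_closedBall_zero_iff] at hx
        linarith
      gcongr)
    (Metric.mem_closedBall_self (norm_nonneg _)) (mem_closedBall_zero_iff.2 le_rfl)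
  refine hmv.trans ?_
  rw [sub_zero, hεn]
  have h2 : 1 + ‖η‖ ≤ 2 * (1 + ‖η‖ ^ 2) := by nlinarith [sq_nonneg (‖η‖ - 1)]
  calc C * (1 + ‖η‖) ^ k * (ε * ‖η‖) ≤ C * (1 + ‖η‖) ^ k * (ε * (1 + ‖η‖)) := by
        gcongr
        linarith
    _ = ε * (C * (1 + ‖η‖) ^ (k + 1)) := by ring
    _ ≤ ε * (C * (2 * (1 + ‖η‖ ^ 2)) ^ (k + 1)) := by gcongr
    _ = _ := by rw [mul_pow]; ring

/-- As `β → 0`, the datum `f_β` tends to the constant `1`, and its pairing with a symbol to the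
value of the symbol at zero frequency. With `ε = β^{1/pbar}` one has `f_β(x) = e^{-V_ε}(εx)`, where
the tensors of `V_ε` are dominated by those of `V`, and the symbol is evaluated at `ε η`. -/
theorem tendsto_symbolPairing_schwartzDatum {pbar : ℕ} (hp : 2 ≤ pbar)
    {lam : (p : ℕ) → (Fin p → Fin d) → ℝ}
    (hlam : ∀ φ : Space d, φ ≠ 0 → 0 < tensorForm (lam pbar) φ)
    {N : Space d → ℂ} (hN : N.HasTemperateGrowth) :
    Tendsto (fun β => symbolPairing N (schwartzDatum pbar lam β)) (𝓝[>] 0) (𝓝 (N 0)) := by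
  obtain ⟨k, C, hC0, hC⟩ := exists_norm_sub_zero_le hN
  obtain ⟨B, hB⟩ := exists_integral_fourier_gibbs_le hp hlam k
  set c : ℂ := ((2 * Real.pi : ℝ) : ℂ)⁻¹ ^ d with hc
  have hbound : ∀ β : ℝ, 0 < β → β ≤ 1 →
      ‖symbolPairing N (schwartzDatum pbar lam β) - N 0 * schwartzDatum pbar lam β 0‖ ≤
        β ^ ((pbar : ℝ)⁻¹) * (‖c‖ * (C * B)) := by
    intro β h0 h1
    set ε := β ^ ((pbar : ℝ)⁻¹) with hε
    have hε0 : 0 < ε := Real.rpow_pos_of_pos h0 _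
    have hε1 : ε ≤ 1 := Real.rpow_le_one h0.le h1 (by positivity)
    have hεp : ε ^ pbar = β := Real.rpow_inv_natCast_pow h0.le (by omega)
    have hd := rescaledTensor_dominated pbar lam hε0.le hε1
    have h' : ∀ φ : Space d, φ ≠ 0 →
        0 < tensorForm (rescaledTensor pbar lam ε pbar) φ := by
      rw [hd.top_eq]
      exact hlam
    set G := gibbs hp h' with hG
    have hfG : ∀ x, schwartzDatum pbar lam β x = G (ε • x) := by
      intro x
      rw [schwartzDatum_apply hp hlam h0, hG, gibbs_apply, potential_rescaledTensor, hεp]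
      simp [initialDatum]
    have hNε : (fun η => N (ε • η)).HasTemperateGrowth := by
      have : (fun η : Space d => ε • η).HasTemperateGrowth := by fun_prop
      exact hN.comp this
    have hconst : (fun _ : Space d => N 0).HasTemperateGrowth := by fun_prop
    have e0 : N 0 * schwartzDatum pbar lam β 0 = symbolPairing (fun _ => N 0) G := by
      rw [hfG, smul_zero, ← symbolPairing_one, symbolPairing_apply hconst,
        symbolPairing_apply (by fun_prop)]
      simp only [one_mul]
      rw [integral_const_mul (N 0)]
      ring
    rw [e0, symbolPairing_dilation hN _ G hε0 hfG, symbolPairing_apply hNε,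
      symbolPairing_apply hconst, ← mul_sub, ← integral_sub
        (integrable_temperate_mul hNε _) (integrable_temperate_mul hconst _), norm_mul, ← hc]
    have hint : Integrable (fun η => polyWeight d k η * schwartzFourier d G η) :=
      integrable_temperate_mul (temperate_polyWeight d k) _
    have h3 : ‖∫ η, (N (ε • η) * schwartzFourier d G η - N 0 * schwartzFourier d G η)‖ ≤
        ∫ η, ε * C * ‖polyWeight d k η * schwartzFourier d G η‖ := by
      refine norm_integral_le_of_norm_le (hint.norm.const_mul _) (Eventually.of_forall fun η => ?_)
      rw [← sub_mul, norm_mul, norm_mul, polyWeight, Complex.norm_real,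
        Real.norm_of_nonneg (by positivity), ← mul_assoc]
      gcongr
      rw [mul_assoc]
      exact hC ε hε0 hε1 η
    rw [integral_const_mul] at h3
    calc _ ≤ ‖c‖ * (ε * C * B) := by
          gcongr
          refine h3.trans ?_
          gcongr
          exact hB _ hd h'
      _ = _ := by ring
  have hlim : Tendsto (fun β : ℝ => β ^ ((pbar : ℝ)⁻¹) * (‖c‖ * (C * B))) (𝓝[>] 0) (𝓝 0) := by
    have h1 : ContinuousAt (fun β : ℝ => β ^ ((pbar : ℝ)⁻¹)) 0 :=
      Real.continuousAt_rpow_const _ _ (Or.inr (by positivity))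
    have h2 := h1.tendsto.mono_left (nhdsWithin_le_nhds (s := Set.Ioi 0))
    have hpb : ((pbar : ℝ)⁻¹) ≠ 0 := by
      have : (0 : ℝ) < pbar := by exact_mod_cast (by omega : 0 < pbar)
      positivity
    rw [Real.zero_rpow hpb] at h2
    simpa using h2.mul_const (‖c‖ * (C * B))
  have hdiff : Tendsto (fun β => symbolPairing N (schwartzDatum pbar lam β) -
      N 0 * schwartzDatum pbar lam β 0) (𝓝[>] 0) (𝓝 0) := by
    refine squeeze_zero_norm' ?_ hlim
    filter_upwards [self_mem_nhdsWithin, nhdsWithin_le_nhds (Iio_mem_nhds one_pos)] with β h0 h1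
    exact hbound β h0 (le_of_lt h1)
  have hval : Tendsto (fun β => N 0 * schwartzDatum pbar lam β 0) (𝓝[>] 0) (𝓝 (N 0)) := by
    have h1 : Continuous (fun β : ℝ => N 0 * initialDatum pbar lam β 0) := by
      unfold initialDatum
      fun_prop
    have h2 := (h1.tendsto 0).mono_left (nhdsWithin_le_nhds (s := Set.Ioi 0))
    have h3 : initialDatum pbar lam 0 0 = 1 := by simp [initialDatum]
    rw [h3, mul_one] at h2
    refine h2.congr' ?_
    filter_upwards [self_mem_nhdsWithin] with β h0
    rw [schwartzDatum_apply hp hlam h0]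
  simpa using hdiff.add hval

/-- Asymptotic Taylor expansion at the boundary point of `(0, ∞)`: it suffices that all
derivatives have limits. -/
theorem isAsymptoticSeries_of_hasDerivAt (N : ℕ) :
    ∀ (h : ℕ → ℝ → ℂ) (a : ℕ → ℂ), (∀ m β, 0 < β → HasDerivAt (h m) (h (m + 1) β) β) →
      (∀ m, Tendsto (h m) (𝓝[>] 0) (𝓝 (a m))) →
      Tendsto (fun β : ℝ => (β ^ N)⁻¹ *
        ‖h 0 β - ∑ m ∈ Finset.range (N + 1), (β : ℂ) ^ m * (a m / (m.factorial : ℂ))‖)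
        (𝓝[>] 0) (𝓝 0) := by
  induction N with
  | zero =>
    intro h a _ hlim
    have := ((hlim 0).sub_const (a 0)).norm
    simpa using this
  | succ N ih =>
    intro h a hd hlim
    have ih' := ih (fun m => h (m + 1)) (fun m => a (m + 1)) (fun m => hd (m + 1))
      (fun m => hlim (m + 1))
    set r : ℝ → ℂ := fun β =>
      h 0 β - ∑ m ∈ Finset.range (N + 2), (β : ℂ) ^ m * (a m / (m.factorial : ℂ)) with hr
    set r' : ℝ → ℂ := fun β =>
      h 1 β - ∑ m ∈ Finset.range (N + 1), (β : ℂ) ^ m * (a (m + 1) / (m.factorial : ℂ)) with hr'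
    have hrd : ∀ β, 0 < β → HasDerivAt r (r' β) β := by
      intro β hβ
      have hs : ∀ m ∈ Finset.range (N + 2), HasDerivAt
          (fun b : ℝ => (b : ℂ) ^ m * (a m / (m.factorial : ℂ)))
          ((m * (β : ℂ) ^ (m - 1) * 1) * (a m / (m.factorial : ℂ))) β := fun m _ =>
        ((Complex.ofRealCLM.hasDerivAt (x := β)).fun_pow m).mul_const _
      refine ((hd 0 β hβ).sub (HasDerivAt.fun_sum hs)).congr_deriv ?_
      simp only [hr']
      congr 1
      rw [Finset.sum_range_succ']
      simp only [Nat.cast_zero, zero_mul, add_zero, mul_one, Nat.add_sub_cancel]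
      refine Finset.sum_congr rfl fun m _ => ?_
      have h1 : ((m + 1 : ℕ) : ℂ) ≠ 0 := by exact_mod_cast Nat.succ_ne_zero m
      have h2 : ((m.factorial : ℕ) : ℂ) ≠ 0 := by exact_mod_cast m.factorial_ne_zero
      rw [Nat.factorial_succ]
      push_cast at h1 ⊢
      field_simp
    have hr0 : Tendsto r (𝓝[>] 0) (𝓝 0) := by
      have hc : Continuous (fun β : ℝ => ∑ m ∈ Finset.range (N + 2),
          (β : ℂ) ^ m * (a m / (m.factorial : ℂ))) := by fun_prop
      have h1 := (hlim 0).sub ((hc.tendsto 0).mono_left (nhdsWithin_le_nhds (s := Set.Ioi 0)))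
      have h2 : ∑ m ∈ Finset.range (N + 2),
          ((0 : ℝ) : ℂ) ^ m * (a m / (m.factorial : ℂ)) = a 0 := by
        rw [Finset.sum_range_succ']
        simp
      rw [h2, sub_self] at h1
      exact h1
    rw [Metric.tendsto_nhds]
    intro e he
    have h1 := (Metric.tendsto_nhds.1 ih') (e / 2) (half_pos he)
    rw [eventually_nhdsWithin_iff, Metric.eventually_nhds_iff] at h1
    obtain ⟨δ, hδ, h1⟩ := h1
    -- the derivative of the remainder is the remainder of the derivative
    have hrb : ∀ x, 0 < x → x < δ → ‖r' x‖ ≤ e / 2 * x ^ N := by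
      intro x hx hxδ
      have := h1 (y := x) (by simpa [abs_of_pos hx] using hxδ) hx
      rw [dist_zero_right, Real.norm_of_nonneg (by positivity)] at this
      rw [inv_mul_lt_iff₀ (by positivity)] at this
      exact this.le.trans (le_of_eq (mul_comm _ _))
    have hmem : ∀ᶠ β in 𝓝[>] (0 : ℝ), β < δ := nhdsWithin_le_nhds (Iio_mem_nhds hδ)
    filter_upwards [self_mem_nhdsWithin, hmem] with β hβ hβδ
    have hβ : 0 < β := hβ
    have hle : ∀ x ∈ Set.Ioo 0 β, ‖r β - r x‖ ≤ e / 2 * β ^ N * β := by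
      intro x hx
      have := (convex_Icc x β).norm_image_sub_le_of_norm_hasDerivWithin_le (f := r) (f' := r')
        (C := e / 2 * β ^ N)
        (fun y hy => (hrd y (hx.1.trans_le hy.1)).hasDerivWithinAt)
        (fun y hy => by
          have hy0 : 0 < y := hx.1.trans_le hy.1
          refine (hrb y hy0 (hy.2.trans_lt hβδ)).trans ?_
          gcongr
          exact hy.2)
        (Set.left_mem_Icc.2 hx.2.le) (Set.right_mem_Icc.2 hx.2.le)
      refine this.trans ?_
      gcongr
      rw [Real.norm_of_nonneg (by linarith [hx.2])]
      linarith [hx.1]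
    have hle0 : ‖r β‖ ≤ e / 2 * β ^ N * β := by
      have h2 : Tendsto (fun x => ‖r β - r x‖) (𝓝[>] 0) (𝓝 ‖r β - 0‖) :=
        (tendsto_const_nhds.sub hr0).norm
      rw [sub_zero] at h2
      refine le_of_tendsto h2 ?_
      filter_upwards [Ioo_mem_nhdsGT hβ] with x hx
      exact hle x hx
    rw [dist_zero_right, Real.norm_of_nonneg (by positivity)]
    change (β ^ (N + 1))⁻¹ * ‖r β‖ < e
    rw [inv_mul_lt_iff₀ (by positivity)]
    calc ‖r β‖ ≤ e / 2 * β ^ N * β := hle0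
      _ = β ^ (N + 1) * (e / 2) := by ring
      _ < β ^ (N + 1) * e := by
          gcongr
          linarith

end SmallCoupling

section SymbolDerivatives

/-! ### Derivatives of the symbol at zero frequency -/

variable {d : ℕ}

/-- The derivation `i ∂/∂ξ_i` on functions of the frequency. It is dual to multiplication of test
functions by the coordinate `φ_i`, and corresponds to `∂/∂z_i` for `z = -iξ`. -/
noncomputable def freqDeriv (i : Fin d) (N : Space d → ℂ) (ξ : Space d) : ℂ :=
  Complex.I * fderiv ℝ N ξ (EuclideanSpace.single i 1)

/-- The smooth functions of the frequency which are analytic at zero frequency. Analyticity gives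
the symmetry of all higher derivatives there. -/
structure IsSymbolAtZero (N : Space d → ℂ) : Prop where
  smooth : ContDiff ℝ ∞ N
  analytic : AnalyticAt ℝ N 0

namespace IsSymbolAtZero

variable {N Q : Space d → ℂ}

theorem differentiable (hN : IsSymbolAtZero N) : Differentiable ℝ N :=
  hN.smooth.differentiable (by simp)

theorem fderiv_apply (hN : IsSymbolAtZero N) (v : Space d) :
    IsSymbolAtZero (fun ξ => fderiv ℝ N ξ v) where
  smooth := (hN.smooth.fderiv_right (by simp)).clm_apply contDiff_const
  analytic := ((ContinuousLinearMap.apply ℝ ℂ v).analyticAt _).comp hN.analytic.fderiv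

theorem freqDeriv (hN : IsSymbolAtZero N) (i : Fin d) : IsSymbolAtZero (freqDeriv i N) where
  smooth := contDiff_const.mul (hN.fderiv_apply _).smooth
  analytic := analyticAt_const.mul (hN.fderiv_apply _).analytic

theorem mul (hQ : IsSymbolAtZero Q) (hN : IsSymbolAtZero N) :
    IsSymbolAtZero (fun ξ => Q ξ * N ξ) :=
  ⟨hQ.smooth.mul hN.smooth, hQ.analytic.mul hN.analytic⟩

theorem add (hQ : IsSymbolAtZero Q) (hN : IsSymbolAtZero N) :
    IsSymbolAtZero (fun ξ => Q ξ + N ξ) :=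
  ⟨hQ.smooth.add hN.smooth, hQ.analytic.add hN.analytic⟩

theorem exp (hN : IsSymbolAtZero N) : IsSymbolAtZero (fun ξ => Complex.exp (N ξ)) :=
  ⟨Complex.contDiff_exp.comp hN.smooth, analyticAt_cexp.restrictScalars.comp hN.analytic⟩

theorem const (c : ℂ) : IsSymbolAtZero (fun _ : Space d => c) :=
  ⟨contDiff_const, analyticAt_const⟩

end IsSymbolAtZero

theorem freqDeriv_mul {Q N : Space d → ℂ} (hQ : Differentiable ℝ Q) (hN : Differentiable ℝ N)
    (i : Fin d) : freqDeriv i (fun ξ => Q ξ * N ξ) =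
      fun ξ => freqDeriv i Q ξ * N ξ + Q ξ * freqDeriv i N ξ := by
  funext ξ
  simp only [freqDeriv]
  rw [fderiv_fun_mul (hQ ξ) (hN ξ)]
  simp
  ring

theorem freqDeriv_exp {Θ : Space d → ℂ} (hΘ : Differentiable ℝ Θ) (i : Fin d) :
    freqDeriv i (fun ξ => Complex.exp (Θ ξ)) =
      fun ξ => freqDeriv i Θ ξ * Complex.exp (Θ ξ) := by
  funext ξ
  simp only [freqDeriv]
  rw [(hΘ ξ).hasFDerivAt.cexp.fderiv]
  simp
  ring

theorem freqDeriv_add {Q N : Space d → ℂ} (hQ : Differentiable ℝ Q) (hN : Differentiable ℝ N)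
    (i : Fin d) : freqDeriv i (fun ξ => Q ξ + N ξ) =
      fun ξ => freqDeriv i Q ξ + freqDeriv i N ξ := by
  funext ξ
  simp only [freqDeriv]
  rw [fderiv_fun_add (hQ ξ) (hN ξ)]
  simp
  ring

variable {L : Type}

/-- The value at zero frequency of `∏_{a ∈ A} (i ∂/∂ξ_{X_a}) N`. -/
noncomputable def zeroDeriv (X : L → Fin d) (A : Finset L) (N : Space d → ℂ) : ℂ :=
  Complex.I ^ A.card * iteratedFDeriv ℝ A.card N 0
    (fun r => EuclideanSpace.single (X (A.equivFin.symm r)) 1)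

/-- The derivative does not depend on the enumeration of the set of directions. -/
theorem zeroDeriv_eq_of_enum (X : L → Fin d) {N : Space d → ℂ} (hN : AnalyticAt ℝ N 0)
    {A : Finset L} {n : ℕ} (hn : A.card = n) (f : Fin n ≃ A) :
    zeroDeriv X A N = Complex.I ^ n * iteratedFDeriv ℝ n N 0
      (fun r => EuclideanSpace.single (X (f r)) 1) := by
  subst hn
  unfold zeroDeriv
  congr 1
  rw [← (hN.contDiffAt (n := ω)).iteratedFDeriv_comp_perm _ (f.trans A.equivFin)]
  congr 1
  funext r
  simp

@[simp]
theorem zeroDeriv_empty (X : L → Fin d) (N : Space d → ℂ) : zeroDeriv X ∅ N = N 0 := by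
  have h : ∀ n : ℕ, n = 0 → ∀ v : Fin n → Space d,
      Complex.I ^ n * iteratedFDeriv ℝ n N 0 v = N 0 := by
    rintro n rfl v
    simp
  exact h _ Finset.card_empty _

/-- The map `ξ ↦ -iξ` from real frequencies to the complex space. -/
noncomputable def imaginaryAxis (d : ℕ) : Space d →L[ℝ] (Fin d → ℂ) :=
  ContinuousLinearMap.pi fun j =>
    (-Complex.I) • (Complex.ofRealCLM.comp (EuclideanSpace.proj (𝕜 := ℝ) (ι := Fin d) j))

theorem imaginaryAxis_apply (ξ : Space d) (j : Fin d) :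
    imaginaryAxis d ξ j = -Complex.I * (ξ j : ℂ) := by
  simp [imaginaryAxis]

theorem axisSymbol_eq_comp (Ψ : (Fin d → ℂ) → ℂ) : axisSymbol Ψ = Ψ ∘ imaginaryAxis d := by
  funext ξ
  simp only [axisSymbol, Function.comp_apply]
  congr 1

theorem IsAdmissibleSymbol.isSymbolAtZero {Ψ : (Fin d → ℂ) → ℂ} (hΨ : IsAdmissibleSymbol Ψ) :
    IsSymbolAtZero (axisSymbol Ψ) where
  smooth := hΨ.smooth
  analytic := by
    rw [axisSymbol_eq_comp]
    have h : AnalyticAt ℝ Ψ (imaginaryAxis d 0) := by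
      rw [_root_.map_zero (imaginaryAxis d)]
      exact hΨ.analytic.restrictScalars
    exact h.comp ((imaginaryAxis d).analyticAt 0)

/-- The derivatives of `ξ ↦ Ψ(-iξ)` at zero. Real and complex derivatives are
compared through the power series of `Ψ` at the origin. -/
theorem iteratedFDeriv_axisSymbol {Ψ : (Fin d → ℂ) → ℂ} (hΨ : IsAdmissibleSymbol Ψ) (n : ℕ)
    (v : Fin n → Space d) : iteratedFDeriv ℝ n (axisSymbol Ψ) 0 v =
      iteratedFDeriv ℂ n Ψ 0 (fun k => imaginaryAxis d (v k)) := by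
  obtain ⟨p, hp⟩ := hΨ.analytic
  have hp' : HasFPowerSeriesAt Ψ (p.restrictScalars ℝ) (imaginaryAxis d 0) := by
    rw [_root_.map_zero (imaginaryAxis d)]
    exact hp.restrictScalars
  have hc : HasFPowerSeriesAt (axisSymbol Ψ)
      ((p.restrictScalars ℝ).compContinuousLinearMap (imaginaryAxis d)) 0 := by
    rw [axisSymbol_eq_comp]
    exact hp'.compContinuousLinearMap
  obtain ⟨r, hr⟩ := hp
  obtain ⟨s, hs⟩ := hc
  rw [hr.iteratedFDeriv_eq_sum_of_completeSpace, hs.iteratedFDeriv_eq_sum_of_completeSpace]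
  rfl

theorem zeroDeriv_axisSymbol {Ψ : (Fin d → ℂ) → ℂ} (hΨ : IsAdmissibleSymbol Ψ) (X : L → Fin d)
    (A : Finset L) : zeroDeriv X A (axisSymbol Ψ) =
      symbolCoeff Ψ A.card (fun r => X (A.equivFin.symm r)) := by
  unfold zeroDeriv symbolCoeff
  rw [iteratedFDeriv_axisSymbol hΨ]
  have h : ∀ i : Fin d, imaginaryAxis d (EuclideanSpace.single i 1) =
      (-Complex.I) • (Pi.single i 1 : Fin d → ℂ) := by
    intro i
    funext j
    rw [imaginaryAxis_apply]
    by_cases hij : j = i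
    · subst hij; simp
    · simp [hij]
  simp only [h]
  rw [ContinuousMultilinearMap.map_smul_univ]
  simp only [Finset.prod_const, Finset.card_univ, Fintype.card_fin, smul_eq_mul]
  rw [← mul_assoc, ← mul_pow]
  simp

variable [DecidableEq L]

/-- In contrast to the definition through an enumeration, this determines `zeroDeriv` by
differentiating in one direction after the other. -/
theorem zeroDeriv_insert (X : L → Fin d) {N : Space d → ℂ} (hN : IsSymbolAtZero N)
    {A : Finset L} {b : L} (hb : b ∉ A) :
    zeroDeriv X (insert b A) N = zeroDeriv X A (freqDeriv (X b) N) := by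
  have hc : (insert b A).card = A.card + 1 := Finset.card_insert_of_notMem hb
  set g : Fin (A.card + 1) → (insert b A : Finset L) := fun r =>
    Fin.lastCases (motive := fun _ => (insert b A : Finset L))
      ⟨b, Finset.mem_insert_self b A⟩
      (fun r => ⟨A.equivFin.symm r, Finset.mem_insert_of_mem (A.equivFin.symm r).2⟩) r with hg
  have hinj : Function.Injective g := by
    intro r s
    refine Fin.lastCases ?_ (fun r => ?_) r <;> refine Fin.lastCases ?_ (fun s => ?_) s
    · simp
    · intro h
      simp only [hg, Fin.lastCases_last, Fin.lastCases_castSucc, Subtype.mk.injEq] at h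
      exact absurd (h ▸ (A.equivFin.symm s).2) hb
    · intro h
      simp only [hg, Fin.lastCases_last, Fin.lastCases_castSucc, Subtype.mk.injEq] at h
      exact absurd (h ▸ (A.equivFin.symm r).2) hb
    · intro h
      simp only [hg, Fin.lastCases_castSucc, Subtype.mk.injEq] at h
      have := A.equivFin.symm.injective (Subtype.ext h)
      rw [this]
  have hbij : Function.Bijective g :=
    (Fintype.bijective_iff_injective_and_card g).2 ⟨hinj, by simp [hc]⟩
  rw [zeroDeriv_eq_of_enum X hN.analytic hc (Equiv.ofBijective g hbij),
    iteratedFDeriv_succ_apply_right]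
  have hfd : ContDiff ℝ ∞ (fderiv ℝ N) := hN.smooth.fderiv_right (by simp)
  rw [← iteratedFDeriv_clm_apply_const_apply hfd (WithTop.coe_le_coe.2 le_top)]
  unfold zeroDeriv
  have e : freqDeriv (X b) N =
      Complex.I • fun ξ => fderiv ℝ N ξ (EuclideanSpace.single (X b) 1) := rfl
  rw [e, iteratedFDeriv_const_smul_apply
    ((hN.fderiv_apply _).smooth.of_le (WithTop.coe_le_coe.2 le_top)).contDiffAt,
    smul_apply, smul_eq_mul, pow_succ, mul_assoc]
  congr 3
  · simp [hg]
  · funext r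
    simp [Fin.init, hg]

theorem zeroDeriv_add (X : L → Fin d) (A : Finset L) {Q N : Space d → ℂ}
    (hQ : IsSymbolAtZero Q) (hN : IsSymbolAtZero N) :
    zeroDeriv X A (fun ξ => Q ξ + N ξ) = zeroDeriv X A Q + zeroDeriv X A N := by
  induction A using Finset.induction_on generalizing Q N with
  | empty => simp
  | insert b A hb ih =>
    rw [zeroDeriv_insert X (hQ.add hN) hb, zeroDeriv_insert X hQ hb, zeroDeriv_insert X hN hb,
      freqDeriv_add hQ.differentiable hN.differentiable, ih (hQ.freqDeriv _) (hN.freqDeriv _)]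

/-- The Leibniz rule. -/
theorem zeroDeriv_mul (X : L → Fin d) (A : Finset L) {Q N : Space d → ℂ}
    (hQ : IsSymbolAtZero Q) (hN : IsSymbolAtZero N) :
    zeroDeriv X A (fun ξ => Q ξ * N ξ) =
      ∑ B ∈ A.powerset, zeroDeriv X B Q * zeroDeriv X (A \ B) N := by
  induction A using Finset.induction_on generalizing Q N with
  | empty => simp
  | insert b A hb ih =>
    have hQ' := hQ.freqDeriv (X b)
    have hN' := hN.freqDeriv (X b)
    rw [zeroDeriv_insert X (hQ.mul hN) hb, freqDeriv_mul hQ.differentiable hN.differentiable,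
      zeroDeriv_add X A (hQ'.mul hN) (hQ.mul hN'), ih hQ' hN, ih hQ hN',
      Finset.sum_powerset_insert hb, add_comm]
    congr 1
    · refine Finset.sum_congr rfl fun B hB => ?_
      have hbB : b ∉ B := fun h => hb (Finset.mem_powerset.1 hB h)
      have hbA : b ∉ A \ B := fun h => hb (Finset.mem_sdiff.1 h).1
      rw [Finset.insert_sdiff_of_notMem _ hbB, zeroDeriv_insert X hN hbA]
    · refine Finset.sum_congr rfl fun B hB => ?_
      have hbB : b ∉ B := fun h => hb (Finset.mem_powerset.1 hB h)
      rw [zeroDeriv_insert X hQ hbB, Finset.insert_sdiff_insert,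
        Finset.sdiff_insert_of_notMem hb]

theorem zeroDeriv_insert_exp (X : L → Fin d) {Θ : Space d → ℂ} (hΘ : IsSymbolAtZero Θ)
    {A : Finset L} {b : L} (hb : b ∉ A) :
    zeroDeriv X (insert b A) (fun ξ => Complex.exp (Θ ξ)) =
      ∑ B ∈ A.powerset, zeroDeriv X (insert b B) Θ *
        zeroDeriv X (A \ B) (fun ξ => Complex.exp (Θ ξ)) := by
  rw [zeroDeriv_insert X hΘ.exp hb, freqDeriv_exp hΘ.differentiable,
    zeroDeriv_mul X A (hΘ.freqDeriv _) hΘ.exp]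
  refine Finset.sum_congr rfl fun B hB => ?_
  rw [zeroDeriv_insert X hΘ fun h => hb (Finset.mem_powerset.1 hB h)]

theorem freqDeriv_const (i : Fin d) (c : ℂ) : freqDeriv i (fun _ : Space d => c) = fun _ => 0 := by
  funext ξ
  simp [freqDeriv]

theorem zeroDeriv_zero (X : L → Fin d) (A : Finset L) :
    zeroDeriv X A (fun _ : Space d => (0 : ℂ)) = 0 := by
  induction A using Finset.induction_on with
  | empty => simp
  | insert b A hb ih => rw [zeroDeriv_insert X (IsSymbolAtZero.const 0) hb, freqDeriv_const, ih]

theorem zeroDeriv_const (X : L → Fin d) (A : Finset L) (c : ℂ) :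
    zeroDeriv X A (fun _ : Space d => c) = if A = ∅ then c else 0 := by
  induction A using Finset.induction_on with
  | empty => simp
  | insert b A hb ih =>
    rw [zeroDeriv_insert X (IsSymbolAtZero.const c) hb, freqDeriv_const, zeroDeriv_zero,
      if_neg (Finset.insert_ne_empty b A)]

/-- The exponent of the symbol of the translation by `φ`. -/
noncomputable def translationExponent (φ ξ : Space d) : ℂ :=
  -Complex.I * ((inner ℝ ξ φ : ℝ) : ℂ)

theorem translationExponent_eq (φ : Space d) : translationExponent φ =
    ((-Complex.I) • (Complex.ofRealCLM.comp (innerSL ℝ φ)) : Space d →L[ℝ] ℂ) := by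
  funext ξ
  simp [translationExponent, real_inner_comm]

theorem isSymbolAtZero_translationExponent (φ : Space d) :
    IsSymbolAtZero (translationExponent φ) := by
  rw [translationExponent_eq]
  exact ⟨ContinuousLinearMap.contDiff _, ContinuousLinearMap.analyticAt _ _⟩

theorem freqDeriv_translationExponent (φ : Space d) (i : Fin d) :
    freqDeriv i (translationExponent φ) = fun _ => (φ i : ℂ) := by
  funext ξ
  rw [freqDeriv, translationExponent_eq, ContinuousLinearMap.fderiv]
  simp [EuclideanSpace.inner_single_right, ← mul_assoc]

theorem zeroDeriv_insert_translationExponent (X : L → Fin d) (φ : Space d) {A : Finset L} {b : L}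
    (hb : b ∉ A) : zeroDeriv X (insert b A) (translationExponent φ) =
      if A = ∅ then (φ (X b) : ℂ) else 0 := by
  rw [zeroDeriv_insert X (isSymbolAtZero_translationExponent φ) hb,
    freqDeriv_translationExponent, zeroDeriv_const]

theorem zeroDeriv_const_mul (X : L → Fin d) (A : Finset L) (c : ℂ) {N : Space d → ℂ}
    (hN : IsSymbolAtZero N) :
    zeroDeriv X A (fun ξ => c * N ξ) = c * zeroDeriv X A N := by
  rw [zeroDeriv_mul X A (IsSymbolAtZero.const c) hN,
    Finset.sum_eq_single_of_mem ∅ (Finset.empty_mem_powerset A)]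
  · simp
  · intro B _ hB
    rw [zeroDeriv_const, if_neg hB, zero_mul]

/-- The exponent of the symbol of `f ↦ (ν_t * f)(φ)`. -/
noncomputable def convExponent (Ψ : (Fin d → ℂ) → ℂ) (t : ℝ) (φ ξ : Space d) : ℂ :=
  t * axisSymbol Ψ ξ + translationExponent φ ξ

theorem IsAdmissibleSymbol.isSymbolAtZero_convExponent {Ψ : (Fin d → ℂ) → ℂ}
    (hΨ : IsAdmissibleSymbol Ψ) (t : ℝ) (φ : Space d) : IsSymbolAtZero (convExponent Ψ t φ) :=
  ((IsSymbolAtZero.const _).mul hΨ.isSymbolAtZero).add (isSymbolAtZero_translationExponent φ)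

/-- The factor of an inner empty vertex at which the legs in `B` end. -/
noncomputable def blockWeight (Ψ : (Fin d → ℂ) → ℂ) (t : ℝ) (X : L → Fin d) (B : Finset L) : ℂ :=
  t * symbolCoeff Ψ B.card (fun r => X (B.equivFin.symm r))

theorem zeroDeriv_insert_convExponent {Ψ : (Fin d → ℂ) → ℂ} (hΨ : IsAdmissibleSymbol Ψ) (t : ℝ)
    (φ : Space d) (X : L → Fin d) {A : Finset L} {b : L} (hb : b ∉ A) :
    zeroDeriv X (insert b A) (convExponent Ψ t φ) =
      blockWeight Ψ t X (insert b A) + if A = ∅ then (φ (X b) : ℂ) else 0 := by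
  have h1 := zeroDeriv_add X (insert b A) ((IsSymbolAtZero.const (t : ℂ)).mul hΨ.isSymbolAtZero)
    (isSymbolAtZero_translationExponent φ)
  unfold convExponent
  rw [h1, zeroDeriv_const_mul X _ _ hΨ.isSymbolAtZero, zeroDeriv_axisSymbol hΨ,
    zeroDeriv_insert_translationExponent X φ hb]
  rfl

/-- The recursion for the moments of `ν_t` translated by `φ`: the last leg is either alone, as an
outer leg, or forms a block together with some of the other legs. -/
theorem zeroDeriv_insert_exp_convExponent {Ψ : (Fin d → ℂ) → ℂ} (hΨ : IsAdmissibleSymbol Ψ)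
    (t : ℝ) (φ : Space d) (X : L → Fin d) {A : Finset L} {b : L} (hb : b ∉ A) :
    zeroDeriv X (insert b A) (fun ξ => Complex.exp (convExponent Ψ t φ ξ)) =
      (φ (X b) : ℂ) * zeroDeriv X A (fun ξ => Complex.exp (convExponent Ψ t φ ξ)) +
      ∑ B ∈ A.powerset, blockWeight Ψ t X (insert b B) *
        zeroDeriv X (A \ B) (fun ξ => Complex.exp (convExponent Ψ t φ ξ)) := by
  rw [zeroDeriv_insert_exp X (hΨ.isSymbolAtZero_convExponent t φ) hb]
  have h : ∀ B ∈ A.powerset, zeroDeriv X (insert b B) (convExponent Ψ t φ) =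
      blockWeight Ψ t X (insert b B) + if B = ∅ then (φ (X b) : ℂ) else 0 := fun B hB =>
    zeroDeriv_insert_convExponent hΨ t φ X fun h => hb (Finset.mem_powerset.1 hB h)
  rw [Finset.sum_congr rfl fun B hB => by rw [h B hB, add_mul], Finset.sum_add_distrib, add_comm]
  congr 1
  rw [Finset.sum_eq_single_of_mem ∅ (Finset.empty_mem_powerset A)]
  · simp
  · intro B _ hB
    rw [if_neg hB, zero_mul]

end SymbolDerivatives

section PartialPartitions

/-! ### Partial partitions -/

variable {L : Type} [DecidableEq L]

/-- The sets of nonempty pairwise disjoint subsets of `A`. The subsets, called blocks, need not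
cover `A`. -/
def partialPartitions (A : Finset L) : Finset (Finset (Finset L)) :=
  A.powerset.powerset.filter fun P => ∅ ∉ P ∧ ∀ B ∈ P, ∀ C ∈ P, B ≠ C → Disjoint B C

theorem mem_partialPartitions {A : Finset L} {P : Finset (Finset L)} :
    P ∈ partialPartitions A ↔ (∀ B ∈ P, B ⊆ A) ∧ (∀ B ∈ P, B.Nonempty) ∧
      ∀ B ∈ P, ∀ C ∈ P, ∀ a, a ∈ B → a ∈ C → B = C := by
  simp only [partialPartitions, Finset.mem_filter, Finset.mem_powerset]
  refine and_congr ?_ (and_congr ?_ ?_)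
  · simp [Finset.subset_iff]
  · constructor
    · intro h B hB
      rw [Finset.nonempty_iff_ne_empty]
      rintro rfl
      exact h hB
    · intro h he
      simpa using h ∅ he
  · constructor
    · intro h B hB C hC a haB haC
      by_contra hne
      exact Finset.disjoint_left.1 (h B hB C hC hne) haB haC
    · intro h B hB C hC hne
      exact Finset.disjoint_left.2 fun a haB haC => hne (h B hB C hC a haB haC)

/-- The sum over the partial partitions of `A`, in which a block `B` has the weight `w B` and an
element outside all blocks the weight `v a`. -/
noncomputable def partitionSum (w : Finset L → ℂ) (v : L → ℂ) (A : Finset L) : ℂ :=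
  ∑ P ∈ partialPartitions A, (∏ B ∈ P, w B) * ∏ a ∈ A \ P.biUnion id, v a

theorem partitionSum_empty (w : Finset L → ℂ) (v : L → ℂ) : partitionSum w v ∅ = 1 := by
  have : partialPartitions (∅ : Finset L) = {∅} := by
    ext P
    rw [mem_partialPartitions, Finset.mem_singleton]
    constructor
    · rintro ⟨h1, h2, -⟩
      refine Finset.eq_empty_of_forall_notMem fun B hB => ?_
      have := h2 B hB
      rw [Finset.subset_empty.1 (h1 B hB)] at this
      simp at this
    · rintro rfl
      simp
  simp [partitionSum, this]

theorem insert_block_mem_partialPartitions {A B : Finset L} {b : L} (hb : b ∉ A) (hB : B ⊆ A)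
    {P : Finset (Finset L)} (hP : P ∈ partialPartitions (A \ B)) :
    insert (insert b B) P ∈ partialPartitions (insert b A) := by
  rw [mem_partialPartitions] at hP ⊢
  obtain ⟨h1, h2, h3⟩ := hP
  have hdis : ∀ C ∈ P, ∀ a ∈ insert b B, a ∉ C := by
    intro C hC a ha haC
    have haAB := Finset.mem_sdiff.1 (h1 C hC haC)
    rcases Finset.mem_insert.1 ha with rfl | ha
    · exact hb haAB.1
    · exact haAB.2 ha
  refine ⟨fun C hC => ?_, fun C hC => ?_, fun C hC D hD a haC haD => ?_⟩
  · rcases Finset.mem_insert.1 hC with rfl | hC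
    · exact Finset.insert_subset_insert b hB
    · exact (h1 C hC).trans (Finset.sdiff_subset.trans (Finset.subset_insert b A))
  · rcases Finset.mem_insert.1 hC with rfl | hC
    · exact Finset.insert_nonempty b B
    · exact h2 C hC
  · rcases Finset.mem_insert.1 hC with rfl | hC <;> rcases Finset.mem_insert.1 hD with rfl | hD
    · rfl
    · exact absurd haD (hdis D hD a haC)
    · exact absurd haC (hdis C hC a haD)
    · exact h3 C hC D hD a haC haD

/-- The recursion obtained by singling out one element `b`, which lies outside all blocks or
together with a subset `B` of the other elements in one block. -/
theorem partitionSum_insert (w : Finset L → ℂ) (v : L → ℂ) {A : Finset L} {b : L} (hb : b ∉ A) :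
    partitionSum w v (insert b A) = v b * partitionSum w v A +
      ∑ B ∈ A.powerset, w (insert b B) * partitionSum w v (A \ B) := by
  unfold partitionSum
  -- the two terms correspond to `b` outside all blocks and to `b` in the block `insert b B`
  rw [← Finset.sum_filter_add_sum_filter_not (partialPartitions (insert b A))
    (fun P => b ∉ P.biUnion id)]
  congr 1
  · have hfil : (partialPartitions (insert b A)).filter (fun P => b ∉ P.biUnion id) =
        partialPartitions A := by
      ext P
      simp only [Finset.mem_filter, mem_partialPartitions, Finset.mem_biUnion, id, not_exists,
        not_and]
      constructor
      · rintro ⟨⟨h1, h2, h3⟩, h4⟩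
        refine ⟨fun B hB a ha => ?_, h2, h3⟩
        rcases Finset.mem_insert.1 (h1 B hB ha) with rfl | h
        · exact absurd ha (h4 B hB)
        · exact h
      · rintro ⟨h1, h2, h3⟩
        exact ⟨⟨fun B hB => (h1 B hB).trans (Finset.subset_insert b A), h2, h3⟩,
          fun B hB h => hb (h1 B hB h)⟩
    rw [hfil, Finset.mul_sum]
    refine Finset.sum_congr rfl fun P hP => ?_
    have hbP : b ∉ P.biUnion id := by
      rw [← hfil] at hP
      exact (Finset.mem_filter.1 hP).2
    rw [Finset.insert_sdiff_of_notMem _ hbP,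
      Finset.prod_insert fun h => hb (Finset.mem_sdiff.1 h).1]
    ring
  · simp only [Finset.mul_sum]
    rw [Finset.sum_sigma']
    symm
    refine Finset.sum_bij (fun x _ => insert (insert b x.1) x.2) ?_ ?_ ?_ ?_
    · rintro ⟨B, P⟩ h
      obtain ⟨hB, hP⟩ := Finset.mem_sigma.1 h
      rw [Finset.mem_filter]
      refine ⟨insert_block_mem_partialPartitions hb (Finset.mem_powerset.1 hB) hP, ?_⟩
      simp
    · rintro ⟨B, P⟩ h ⟨C, Q⟩ h' heq
      obtain ⟨hB, hP⟩ := Finset.mem_sigma.1 h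
      obtain ⟨hC, hQ⟩ := Finset.mem_sigma.1 h'
      have hbB : b ∉ B := fun h => hb (Finset.mem_powerset.1 hB h)
      have hbC : b ∉ C := fun h => hb (Finset.mem_powerset.1 hC h)
      have hbP : insert b B ∉ P := fun h => hb (Finset.mem_sdiff.1
        ((mem_partialPartitions.1 hP).1 _ h (Finset.mem_insert_self b B))).1
      have hbQ : ∀ D, b ∈ D → D ∉ Q := fun D hD h => hb (Finset.mem_sdiff.1
        ((mem_partialPartitions.1 hQ).1 _ h hD)).1
      have hBC : insert b B = insert b C := by
        have h1 : insert b B ∈ insert (insert b C) Q := by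
          have := Finset.mem_insert_self (insert b B) P
          simp only at heq
          rwa [heq] at this
        rcases Finset.mem_insert.1 h1 with h1 | h1
        · exact h1
        · exact absurd h1 (hbQ _ (Finset.mem_insert_self b B))
      have hPQ : P = Q := by
        have h1 := congrArg (fun S => S.erase (insert b B)) heq
        simp only at h1
        rw [Finset.erase_insert hbP, hBC,
          Finset.erase_insert (hbQ _ (Finset.mem_insert_self b C))] at h1
        exact h1
      have hBC' : B = C := by
        rw [← Finset.erase_insert hbB, hBC, Finset.erase_insert hbC]
      rw [hBC', hPQ]
    · intro P hP
      obtain ⟨hP, hbP⟩ := Finset.mem_filter.1 hP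
      rw [not_not, Finset.mem_biUnion] at hbP
      obtain ⟨D, hD, hbD⟩ := hbP
      obtain ⟨h1, h2, h3⟩ := mem_partialPartitions.1 hP
      have hbD : b ∈ D := hbD
      refine ⟨⟨D.erase b, P.erase D⟩, Finset.mem_sigma.2 ⟨?_, ?_⟩, ?_⟩
      · refine Finset.mem_powerset.2 fun a ha => ?_
        obtain ⟨hab, haD⟩ := Finset.mem_erase.1 ha
        exact (Finset.mem_insert.1 (h1 D hD haD)).resolve_left hab
      · refine mem_partialPartitions.2 ⟨fun C hC a ha => ?_, fun C hC =>
          h2 C (Finset.mem_of_mem_erase hC), fun C hC E hE => h3 C (Finset.mem_of_mem_erase hC) E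
          (Finset.mem_of_mem_erase hE)⟩
        obtain ⟨hCD, hC⟩ := Finset.mem_erase.1 hC
        have haD : a ∉ D := fun h => hCD (h3 C hC D hD a ha h)
        have hab : a ≠ b := by
          rintro rfl
          exact haD hbD
        exact Finset.mem_sdiff.2 ⟨(Finset.mem_insert.1 (h1 C hC ha)).resolve_left hab,
          fun h => haD (Finset.mem_of_mem_erase h)⟩
      · simp only
        rw [Finset.insert_erase hbD, Finset.insert_erase hD]
    · rintro ⟨B, P⟩ h
      obtain ⟨hB, hP⟩ := Finset.mem_sigma.1 h
      have hbP : insert b B ∉ P := fun h => hb (Finset.mem_sdiff.1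
        ((mem_partialPartitions.1 hP).1 _ h (Finset.mem_insert_self b B))).1
      simp only
      rw [Finset.prod_insert hbP, mul_assoc]
      congr 3
      ext a
      simp only [Finset.mem_sdiff, Finset.mem_biUnion, id, Finset.mem_insert, not_exists, not_and]
      constructor
      · rintro ⟨⟨haA, haB⟩, haP⟩
        refine ⟨Or.inr haA, fun C hC => ?_⟩
        rcases hC with rfl | hC
        · intro h
          rcases Finset.mem_insert.1 h with rfl | h
          · exact hb haA
          · exact haB h
        · exact haP C hC
      · rintro ⟨haA, haP⟩
        have h1 := haP _ (Or.inl rfl)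
        rw [Finset.mem_insert, not_or] at h1
        exact ⟨⟨haA.resolve_left h1.1, h1.2⟩, fun C hC => haP C (Or.inr hC)⟩

theorem eq_partitionSum_of_recursion (w : Finset L → ℂ) (v : L → ℂ) {T : Finset L → ℂ}
    (h0 : T ∅ = 1)
    (hT : ∀ (A : Finset L) (b : L), b ∉ A → T (insert b A) = v b * T A +
      ∑ B ∈ A.powerset, w (insert b B) * T (A \ B)) (A : Finset L) :
    T A = partitionSum w v A := by
  induction A using Finset.strongInduction with
  | H A ih =>
    rcases A.eq_empty_or_nonempty with rfl | ⟨b, hbA⟩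
    · rw [h0, partitionSum_empty]
    · obtain ⟨A, hb, rfl⟩ : ∃ A', b ∉ A' ∧ insert b A' = A :=
        ⟨A.erase b, Finset.notMem_erase b A, Finset.insert_erase hbA⟩
      rw [hT A b hb, partitionSum_insert w v hb, ih A (Finset.ssubset_insert hb)]
      congr 1
      refine Finset.sum_congr rfl fun B _ => ?_
      rw [ih (A \ B) (lt_of_le_of_lt Finset.sdiff_subset (Finset.ssubset_insert hb))]

end PartialPartitions

section Graphs

/-! ### Feynman graphs as partial partitions of the legs -/

namespace LabelledGraph

variable {m : ℕ} {p : Fin m → ℕ}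

theorem mem_legsAt {G : LabelledGraph p} {x : Fin G.k ⊕ Fin G.q} {a : Leg p} :
    a ∈ G.legsAt x ↔ G.graph.Adj (Sum.inl a) (Sum.inr x) := by
  simp [legsAt, SimpleGraph.adj_comm]

theorem eq_of_mem_legsAt {G : LabelledGraph p} {x y : Fin G.k ⊕ Fin G.q} {a : Leg p}
    (hx : a ∈ G.legsAt x) (hy : a ∈ G.legsAt y) : x = y :=
  Sum.inr_injective ((G.leg a).unique (mem_legsAt.1 hx) (mem_legsAt.1 hy))

theorem legsAt_nonempty (G : LabelledGraph p) (x : Fin G.k ⊕ Fin G.q) : (G.legsAt x).Nonempty := by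
  obtain ⟨a, ha⟩ := G.exists_leg x
  exact ⟨a, mem_legsAt.2 ha⟩

theorem legsAt_injective (G : LabelledGraph p) : Function.Injective G.legsAt := by
  intro x y h
  obtain ⟨a, ha⟩ := G.legsAt_nonempty x
  exact eq_of_mem_legsAt ha (h ▸ ha)

theorem exists_mem_legsAt (G : LabelledGraph p) (a : Leg p) : ∃ x, a ∈ G.legsAt x := by
  obtain ⟨y, hy, -⟩ := G.leg a
  rcases y with b | x
  · exact absurd hy (G.not_full_full a b)
  · exact ⟨x, mem_legsAt.2 hy⟩

/-- The sets of legs which end at the same inner empty vertex. -/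
noncomputable def blocks (G : LabelledGraph p) : Finset (Finset (Leg p)) :=
  Finset.univ.image fun i : Fin G.k => G.legsAt (Sum.inl i)

/-- The legs which end at an outer empty vertex. -/
noncomputable def outerLegs (G : LabelledGraph p) : Finset (Leg p) :=
  Finset.univ \ G.blocks.biUnion id

theorem mem_outerLegs {G : LabelledGraph p} {a : Leg p} :
    a ∈ G.outerLegs ↔ ∃ o, a ∈ G.legsAt (Sum.inr o) := by
  simp only [outerLegs, blocks, Finset.mem_sdiff, Finset.mem_univ, true_and, Finset.mem_biUnion,
    Finset.mem_image, id, not_exists, not_and]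
  constructor
  · intro h
    obtain ⟨x | o, hx⟩ := G.exists_mem_legsAt a
    · exact absurd hx (h _ ⟨x, rfl⟩)
    · exact ⟨o, hx⟩
  · rintro ⟨o, ho⟩ B ⟨i, rfl⟩ hi
    cases eq_of_mem_legsAt ho hi

theorem legsAt_outer (G : LabelledGraph p) (o : Fin G.q) {a : Leg p}
    (ha : a ∈ G.legsAt (Sum.inr o)) : G.legsAt (Sum.inr o) = {a} := by
  ext b
  rw [Finset.mem_singleton]
  constructor
  · intro hb
    exact Sum.inl_injective ((G.outer o).unique (mem_legsAt.1 hb).symm (mem_legsAt.1 ha).symm)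
  · rintro rfl
    exact ha

/-- An outer empty vertex is the same as a leg outside the blocks. -/
theorem image_legsAt_outer (G : LabelledGraph p) :
    (Finset.univ.image fun o : Fin G.q => G.legsAt (Sum.inr o)) =
      G.outerLegs.image fun a => {a} := by
  ext B
  simp only [Finset.mem_image, Finset.mem_univ, true_and, mem_outerLegs]
  constructor
  · rintro ⟨o, rfl⟩
    obtain ⟨a, ha⟩ := G.legsAt_nonempty (Sum.inr o)
    exact ⟨a, ⟨o, ha⟩, (G.legsAt_outer o ha).symm⟩
  · rintro ⟨a, ⟨o, ha⟩, rfl⟩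
    exact ⟨o, G.legsAt_outer o ha⟩

theorem blocks_mem (G : LabelledGraph p) : G.blocks ∈ partialPartitions Finset.univ := by
  rw [mem_partialPartitions]
  simp only [blocks, Finset.mem_image, Finset.mem_univ, true_and]
  refine ⟨fun _ _ => Finset.subset_univ _, ?_, ?_⟩
  · rintro _ ⟨i, rfl⟩
    exact G.legsAt_nonempty _
  · rintro _ ⟨i, rfl⟩ _ ⟨j, rfl⟩ a hi hj
    rw [eq_of_mem_legsAt hi hj]

theorem Same.legsAt_eq {G H : LabelledGraph p} {e : Fin G.k ≃ Fin H.k} {o : Fin G.q ≃ Fin H.q}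
    (h : ∀ x y, G.graph.Adj x y ↔
      H.graph.Adj (Sum.map id (Sum.map e o) x) (Sum.map id (Sum.map e o) y))
    (x : Fin G.k ⊕ Fin G.q) : G.legsAt x = H.legsAt (Sum.map e o x) := by
  ext a
  rw [mem_legsAt, mem_legsAt, h]
  rfl

theorem Same.blocks_eq {G H : LabelledGraph p} (h : G.Same H) : G.blocks = H.blocks := by
  obtain ⟨e, o, h⟩ := h
  ext B
  simp only [blocks, Finset.mem_image, Finset.mem_univ, true_and]
  rw [← e.exists_congr_right]
  refine exists_congr fun i => ?_
  rw [Same.legsAt_eq h]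
  rfl

theorem exists_equiv_of_image_eq {S : Type} [DecidableEq S] {k l : ℕ} {f : Fin k → S}
    {g : Fin l → S} (hf : Function.Injective f) (hg : Function.Injective g)
    (h : Finset.univ.image f = Finset.univ.image g) : ∃ e : Fin k ≃ Fin l, ∀ i, f i = g (e i) := by
  have h1 : ∀ i, ∃ j, g j = f i := fun i => by
    have : f i ∈ Finset.univ.image g := h ▸ Finset.mem_image_of_mem f (Finset.mem_univ i)
    simpa using this
  choose e he using h1
  have hinj : Function.Injective e := fun i j hij => hf (by rw [← he, ← he, hij])
  have hsurj : Function.Surjective e := by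
    intro j
    have : g j ∈ Finset.univ.image f := h ▸ Finset.mem_image_of_mem g (Finset.mem_univ j)
    obtain ⟨i, -, hi⟩ := Finset.mem_image.1 this
    exact ⟨i, hg (by rw [he, hi])⟩
  exact ⟨Equiv.ofBijective e ⟨hinj, hsurj⟩, fun i => (he i).symm⟩

/-- The blocks determine a graph up to the labels of the empty vertices: they determine the sets of
legs ending at each of the empty vertices, outer ones included, and these sets are distinct. -/
theorem same_of_blocks_eq {G H : LabelledGraph p} (h : G.blocks = H.blocks) : G.Same H := by
  obtain ⟨e, he⟩ := exists_equiv_of_image_eq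
    (G.legsAt_injective.comp Sum.inl_injective) (H.legsAt_injective.comp Sum.inl_injective) h
  have hout : G.outerLegs = H.outerLegs := by rw [outerLegs, outerLegs, h]
  obtain ⟨o, ho⟩ := exists_equiv_of_image_eq
    (G.legsAt_injective.comp Sum.inr_injective) (H.legsAt_injective.comp Sum.inr_injective)
    ((G.image_legsAt_outer.trans (by rw [hout])).trans H.image_legsAt_outer.symm)
  have hx : ∀ x, G.legsAt x = H.legsAt (Sum.map e o x) := by
    rintro (i | j)
    · exact he i
    · exact ho j
  have hadj : ∀ a x, G.graph.Adj (Sum.inl a) (Sum.inr x) ↔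
      H.graph.Adj (Sum.inl a) (Sum.inr (Sum.map e o x)) := fun a x => by
    rw [← mem_legsAt, ← mem_legsAt, hx]
  refine ⟨e, o, ?_⟩
  rintro (a | x) (b | y)
  · exact iff_of_false (G.not_full_full a b) (H.not_full_full a b)
  · exact hadj a y
  · rw [SimpleGraph.adj_comm, hadj, SimpleGraph.adj_comm]
    rfl
  · exact iff_of_false (G.not_empty_empty x y) (H.not_empty_empty _ _)

/-- The graph in which the leg `a` is connected with the empty vertex `f a`. -/
def ofEnd {k q : ℕ} (f : Leg p → Fin k ⊕ Fin q) (hi : ∀ i, ∃ a, f a = Sum.inl i)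
    (ho : ∀ o, ∃! a, f a = Sum.inr o) : LabelledGraph p where
  k := k
  q := q
  graph :=
    { Adj := fun x y => (∃ a, x = Sum.inl a ∧ y = Sum.inr (f a)) ∨
        ∃ a, y = Sum.inl a ∧ x = Sum.inr (f a)
      symm := ⟨fun _ _ h => h.symm⟩
      loopless := ⟨by rintro _ (⟨a, rfl, h⟩ | ⟨a, rfl, h⟩) <;> cases h⟩ }
  not_full_full a b := by simp
  not_empty_empty x y := by simp
  leg a := ⟨Sum.inr (f a), by simp, by simp⟩
  inner i := by
    obtain ⟨a, ha⟩ := hi i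
    exact ⟨Sum.inl a, Or.inr ⟨a, rfl, by rw [ha]⟩⟩
  outer o := by
    obtain ⟨a, ha, huniq⟩ := ho o
    refine ⟨Sum.inl a, Or.inr ⟨a, rfl, by rw [ha]⟩, ?_⟩
    rintro y (⟨b, h, -⟩ | ⟨b, rfl, h⟩)
    · cases h
    · rw [huniq b (Sum.inr_injective h).symm]

theorem mem_legsAt_ofEnd {k q : ℕ} {f : Leg p → Fin k ⊕ Fin q} (hi : ∀ i, ∃ a, f a = Sum.inl i)
    (ho : ∀ o, ∃! a, f a = Sum.inr o) (x : Fin k ⊕ Fin q) (a : Leg p) :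
    a ∈ (ofEnd f hi ho).legsAt x ↔ f a = x := by
  refine mem_legsAt.trans ?_
  change ((∃ b, _ ∧ _) ∨ ∃ b, _ ∧ _) ↔ _
  constructor
  · rintro (⟨b, h, h'⟩ | ⟨b, h, -⟩)
    · rw [Sum.inl_injective h]
      exact (Sum.inr_injective h').symm
    · cases h
  · intro h
    exact Or.inl ⟨a, rfl, congrArg Sum.inr h.symm⟩

/-- Every partial partition of the legs comes from a graph: there is an inner empty vertex for each
block and an outer empty vertex for each leg outside the blocks. -/
theorem exists_blocks_eq {P : Finset (Finset (Leg p))}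
    (hP : P ∈ partialPartitions Finset.univ) : ∃ G : LabelledGraph p, G.blocks = P := by
  classical
  obtain ⟨-, h2, h3⟩ := mem_partialPartitions.1 hP
  set O : Finset (Leg p) := Finset.univ \ P.biUnion id with hO
  have hmemO : ∀ a, (¬ ∃ B ∈ P, a ∈ B) → a ∈ O := by
    intro a ha
    simp only [hO, Finset.mem_sdiff, Finset.mem_univ, true_and, Finset.mem_biUnion, id]
    exact ha
  have hmemO' : ∀ a ∈ O, ¬ ∃ B ∈ P, a ∈ B := by
    intro a ha
    simpa only [hO, Finset.mem_sdiff, Finset.mem_univ, true_and, Finset.mem_biUnion, id] using ha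
  set f : Leg p → Fin P.card ⊕ Fin O.card := fun a =>
    if h : ∃ B ∈ P, a ∈ B then Sum.inl (P.equivFin ⟨h.choose, h.choose_spec.1⟩)
    else Sum.inr (O.equivFin ⟨a, hmemO a h⟩) with hf
  have hfin : ∀ a (B : P), a ∈ B.1 → f a = Sum.inl (P.equivFin B) := by
    intro a B ha
    have h : ∃ B ∈ P, a ∈ B := ⟨B.1, B.2, ha⟩
    simp only [hf]
    rw [dif_pos h]
    congr 2
    exact Subtype.ext (h3 _ h.choose_spec.1 _ B.2 a h.choose_spec.2 ha)
  have hfout : ∀ a : O, f a.1 = Sum.inr (O.equivFin a) := by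
    intro a
    simp only [hf]
    rw [dif_neg (hmemO' a.1 a.2)]
  have hfin' : ∀ a (B : P), f a = Sum.inl (P.equivFin B) ↔ a ∈ B.1 := by
    intro a B
    refine ⟨fun h => ?_, hfin a B⟩
    by_cases h' : ∃ B ∈ P, a ∈ B
    · obtain ⟨C, hC, haC⟩ := h'
      rw [hfin a ⟨C, hC⟩ haC] at h
      have := P.equivFin.injective (Sum.inl_injective h)
      rw [← this]
      exact haC
    · rw [hfout ⟨a, hmemO a h'⟩] at h
      cases h
  have hi : ∀ i, ∃ a, f a = Sum.inl i := by
    intro i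
    obtain ⟨a, ha⟩ := h2 _ (P.equivFin.symm i).2
    exact ⟨a, by rw [hfin a _ ha, Equiv.apply_symm_apply]⟩
  have ho : ∀ o, ∃! a, f a = Sum.inr o := by
    intro o
    refine ⟨(O.equivFin.symm o).1, (hfout _).trans (by rw [Equiv.apply_symm_apply]),
      fun b (hb : f b = Sum.inr o) => ?_⟩
    by_cases h' : ∃ B ∈ P, b ∈ B
    · obtain ⟨C, hC, hbC⟩ := h'
      rw [hfin b ⟨C, hC⟩ hbC] at hb
      cases hb
    · rw [hfout ⟨b, hmemO b h'⟩] at hb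
      rw [← Sum.inr_injective hb, Equiv.symm_apply_apply]
  refine ⟨ofEnd f hi ho, ?_⟩
  ext B
  have hl : ∀ i : Fin P.card, (ofEnd f hi ho).legsAt (Sum.inl i) = (P.equivFin.symm i).1 := by
    intro i
    ext a
    refine (mem_legsAt_ofEnd hi ho (Sum.inl i) a).trans ?_
    rw [← hfin' a (P.equivFin.symm i), Equiv.apply_symm_apply]
  have : B ∈ (ofEnd f hi ho).blocks ↔
      ∃ i : Fin P.card, (ofEnd f hi ho).legsAt (Sum.inl i) = B := by
    rw [blocks, Finset.mem_image]
    simp only [Finset.mem_univ, true_and]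
    exact Iff.rfl
  rw [this]
  simp only [hl]
  constructor
  · rintro ⟨i, rfl⟩
    exact (P.equivFin.symm i).2
  · intro hB
    exact ⟨P.equivFin ⟨B, hB⟩, by rw [Equiv.symm_apply_apply]⟩

/-- A graph with undistinguished empty vertices is the same as a partial partition of the legs:
the blocks are the sets of legs ending at the same inner empty vertex. -/
noncomputable def quotientEquiv (p : Fin m → ℕ) : Quotient (LabelledGraph.setoid p) ≃
    (partialPartitions (Finset.univ : Finset (Leg p)) : Finset (Finset (Finset (Leg p)))) :=
  Equiv.ofBijective (Quotient.lift (fun G => ⟨G.blocks, G.blocks_mem⟩)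
    fun _ _ h => Subtype.ext (Same.blocks_eq h)) (by
      constructor
      · rintro ⟨G⟩ ⟨H⟩ h
        exact Quotient.sound (same_of_blocks_eq (congrArg Subtype.val h))
      · rintro ⟨P, hP⟩
        obtain ⟨G, rfl⟩ := exists_blocks_eq hP
        exact ⟨⟦G⟧, rfl⟩)

theorem value_eq {d : ℕ} (Ψ : (Fin d → ℂ) → ℂ) (lam : (p : ℕ) → (Fin p → Fin d) → ℝ) (t : ℝ)
    (φ : Space d) (G : LabelledGraph p) :
    G.value Ψ lam t φ = ∑ X : Leg p → Fin d,
      (∏ j : Fin m, ((lam (p j) (fun l => X ⟨j, l⟩) : ℝ) : ℂ)) *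
        ((∏ B ∈ G.blocks, blockWeight Ψ t X B) *
          ∏ a ∈ Finset.univ \ G.blocks.biUnion id, ((φ (X a) : ℝ) : ℂ)) := by
  unfold value
  refine Finset.sum_congr rfl fun X _ => ?_
  rw [mul_assoc, mul_comm (∏ B ∈ G.blocks, _)]
  congr 2
  · rw [← Finset.prod_biUnion]
    · refine Finset.prod_congr ?_ fun _ _ => rfl
      ext a
      rw [Finset.mem_biUnion]
      change _ ↔ a ∈ G.outerLegs
      simp [mem_outerLegs]
    · intro o _ o' _ hne
      exact Finset.disjoint_left.2 fun a ha ha' =>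
        hne (Sum.inr_injective (eq_of_mem_legsAt ha ha'))
  · rw [blocks, Finset.prod_image fun i _ j _ h => Sum.inl_injective (G.legsAt_injective h)]
    rfl

end LabelledGraph

/-- The sum over all graphs with `m` inner full vertices, as a sum over the numbers of legs and
the labels of the legs. Vertices with a vanishing tensor contribute zero. -/
theorem sum_value_eq {d : ℕ} (pbar : ℕ) (lam : (p : ℕ) → (Fin p → Fin d) → ℝ) (m : ℕ)
    (Ψ : (Fin d → ℂ) → ℂ) (t : ℝ) (φ : Space d) :
    ∑ G : FeynmanGraph pbar lam m, G.value Ψ t φ =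
      ∑ p : Fin m → Fin (pbar + 1), ∑ X : Leg (fun j => (p j : ℕ)) → Fin d,
        (∏ j : Fin m, ((lam (p j) (fun l => X ⟨j, l⟩) : ℝ) : ℂ)) *
          partitionSum (blockWeight Ψ t X) (fun a => ((φ (X a) : ℝ) : ℂ)) Finset.univ := by
  classical
  set F : (p : {p : Fin m → Fin (pbar + 1) // ∀ j, lam (p j) ≠ 0}) →
      (partialPartitions (Finset.univ : Finset (Leg (fun j => (p.1 j : ℕ)))) :
        Finset (Finset (Finset _))) → ℂ := fun p P =>
    ∑ X : Leg (fun j => (p.1 j : ℕ)) → Fin d,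
      (∏ j : Fin m, ((lam (p.1 j) (fun l => X ⟨j, l⟩) : ℝ) : ℂ)) *
        ((∏ B ∈ P.1, blockWeight Ψ t X B) *
          ∏ a ∈ Finset.univ \ P.1.biUnion id, ((φ (X a) : ℝ) : ℂ)) with hF
  let e : FeynmanGraph pbar lam m ≃ Σ p : {p : Fin m → Fin (pbar + 1) // ∀ j, lam (p j) ≠ 0},
      (partialPartitions (Finset.univ : Finset (Leg (fun j => (p.1 j : ℕ)))) :
        Finset (Finset (Finset _))) :=
    Equiv.sigmaCongrRight fun p => LabelledGraph.quotientEquiv (fun j => (p.1 j : ℕ))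
  have h1 : ∑ G : FeynmanGraph pbar lam m, G.value Ψ t φ = ∑ x, F (e x).1 (e x).2 := by
    refine Finset.sum_congr rfl fun G _ => ?_
    obtain ⟨p, ⟨G⟩⟩ := G
    exact LabelledGraph.value_eq Ψ lam t φ G
  rw [h1, e.sum_comp (fun x => F x.1 x.2), Fintype.sum_sigma]
  set f : (Fin m → Fin (pbar + 1)) → ℂ := fun p =>
    ∑ X : Leg (fun j => (p j : ℕ)) → Fin d,
        (∏ j : Fin m, ((lam (p j) (fun l => X ⟨j, l⟩) : ℝ) : ℂ)) *
          partitionSum (blockWeight Ψ t X) (fun a => ((φ (X a) : ℝ) : ℂ)) Finset.univ with hf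
  have h2 : ∀ p : {p : Fin m → Fin (pbar + 1) // ∀ j, lam (p j) ≠ 0},
      ∑ y, F p y = f p.1 := by
    intro p
    simp only [hF, hf]
    rw [Finset.sum_comm]
    refine Finset.sum_congr rfl fun X _ => ?_
    rw [← Finset.mul_sum, partitionSum]
    congr 1
    exact Finset.sum_coe_sort (partialPartitions Finset.univ) fun P =>
      (∏ B ∈ P, blockWeight Ψ t X B) * ∏ a ∈ Finset.univ \ P.biUnion id, ((φ (X a) : ℝ) : ℂ)
  rw [Finset.sum_congr rfl fun p _ => h2 p]
  have h3 : ∀ p : Fin m → Fin (pbar + 1), ¬ (∀ j, lam (p j) ≠ 0) → f p = 0 := by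
    intro p hp
    push Not at hp
    obtain ⟨j, hj⟩ := hp
    refine Finset.sum_eq_zero fun X _ => ?_
    rw [Finset.prod_eq_zero (Finset.mem_univ j) (by rw [hj]; simp), zero_mul]
  rw [← Finset.sum_filter_of_ne (s := Finset.univ) (f := f)
    (p := fun p : Fin m → Fin (pbar + 1) => ∀ j, lam (p j) ≠ 0) fun p _ hp =>
      by_contra fun h => hp (h3 p h)]
  exact (Finset.sum_subtype (Finset.univ.filter fun p : Fin m → Fin (pbar + 1) =>
    ∀ j, lam (p j) ≠ 0) (by simp) f).symm

end Graphs

section Expansion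

/-! ### The coefficients of the expansion -/

variable {d : ℕ}

theorem temperate_ofReal {f : Space d → ℝ} (hf : f.HasTemperateGrowth) :
    (fun x => (f x : ℂ)).HasTemperateGrowth :=
  Function.HasTemperateGrowth.comp Function.Complex.hasTemperateGrowth_ofReal hf

theorem temperate_exp_convExponent {Ψ : (Fin d → ℂ) → ℂ} (hΨ : IsAdmissibleSymbol Ψ) {t : ℝ}
    (ht : 0 ≤ t) (φ : Space d) :
    (fun ξ => Complex.exp (convExponent Ψ t φ ξ)).HasTemperateGrowth := by
  have h1 : IsExpMultiplier (translationExponent φ) :=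
    { temperate := (Function.HasTemperateGrowth.const _).mul
        (inner_hasTemperateGrowth φ)
      exp_le := ⟨0, 1, fun ξ => by simp [translationExponent]⟩ }
  have h := (hΨ.isExpMultiplier.temperate_exp ht).mul (h1.temperate_exp zero_le_one)
  have e : (fun ξ => Complex.exp (convExponent Ψ t φ ξ)) =
      (fun y => Complex.exp (t * axisSymbol Ψ y)) *
        fun y => Complex.exp ((1 : ℝ) * translationExponent φ y) := by
    funext ξ
    simp [convExponent, Complex.exp_add]
  rw [e]
  exact h

/-- `f ↦ (ν_t * f)(φ)` is the pairing with the symbol `e^{tΨ(-iξ) - i⟨ξ,φ⟩}`. -/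
theorem nuConv_eq_symbolPairing {Ψ : (Fin d → ℂ) → ℂ} (hΨ : IsAdmissibleSymbol Ψ) {t : ℝ}
    (ht : 0 ≤ t) (f : 𝓢(Space d, ℂ)) (φ : Space d) :
    nuConv Ψ t f φ = symbolPairing (fun ξ => Complex.exp (convExponent Ψ t φ ξ)) f := by
  rw [nuConv_eq_integral, symbolPairing_apply (temperate_exp_convExponent hΨ ht φ),
    schwartzFourier_coe]
  rfl

/-- `V^m` as a sum over the numbers of legs and the labels of the legs of `m` full vertices. -/
theorem potential_pow (pbar : ℕ) (lam : (p : ℕ) → (Fin p → Fin d) → ℝ) (m : ℕ) (x : Space d) :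
    potential pbar lam x ^ m =
      ∑ p : Fin m → Fin (pbar + 1), ∑ X : Leg (fun j => (p j : ℕ)) → Fin d,
        (∏ j : Fin m, lam (p j) (fun l => X ⟨j, l⟩)) * ∏ a, x (X a) := by
  unfold potential tensorForm
  rw [Finset.sum_range, Fintype.sum_pow]
  refine Finset.sum_congr rfl fun p _ => ?_
  rw [Finset.prod_univ_sum, Fintype.piFinset_univ,
    ← (Equiv.piCurry fun (j : Fin m) (_ : Fin (p j)) => Fin d).sum_comp]
  refine Finset.sum_congr rfl fun X _ => ?_
  rw [Finset.prod_mul_distrib, Fintype.prod_sigma]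
  rfl

variable {pbar : ℕ} {lam : (p : ℕ) → (Fin p → Fin d) → ℝ}

theorem temperate_neg_potential_pow (pbar : ℕ) (lam : (p : ℕ) → (Fin p → Fin d) → ℝ) (m : ℕ) :
    (fun x : Space d => (-(potential pbar lam x : ℂ)) ^ m).HasTemperateGrowth :=
  (temperate_ofReal (temperate_potential pbar lam)).neg.pow m

theorem temperate_coord_prod {L : Type} (X : L → Fin d) (A : Finset L) :
    (fun x : Space d => ∏ a ∈ A, (x (X a) : ℂ)).HasTemperateGrowth :=
  temperate_prod A fun a _ => temperate_ofReal (temperate_coord (X a))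

/-- As `β → 0` the pairing of a symbol with a monomial times `e^{-βV}` tends to the corresponding
derivative of the symbol at zero frequency. -/
theorem tendsto_symbolPairing_monomial (hp : 2 ≤ pbar)
    (hlam : ∀ φ : Space d, φ ≠ 0 → 0 < tensorForm (lam pbar) φ) {L : Type} [DecidableEq L]
    (X : L → Fin d) (A : Finset L) {N : Space d → ℂ} (hN : N.HasTemperateGrowth)
    (hN0 : IsSymbolAtZero N) :
    Tendsto (fun β => symbolPairing N (SchwartzMap.smulLeftCLM ℂ
      (fun x : Space d => ∏ a ∈ A, (x (X a) : ℂ)) (schwartzDatum pbar lam β))) (𝓝[>] 0)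
      (𝓝 (zeroDeriv X A N)) := by
  induction A using Finset.induction_on generalizing N with
  | empty =>
    rw [zeroDeriv_empty]
    simpa using tendsto_symbolPairing_schwartzDatum hp hlam hN
  | insert b A hb ih =>
    have hN' : (freqDeriv (X b) N).HasTemperateGrowth :=
      (Function.HasTemperateGrowth.const _).mul (temperate_fderiv_apply hN _)
    rw [zeroDeriv_insert X hN0 hb]
    refine (ih hN' (hN0.freqDeriv (X b))).congr fun β => ?_
    have hc : (fun x : Space d =>
        ((inner ℝ x (EuclideanSpace.single (X b) (1 : ℝ)) : ℝ) : ℂ)) = fun x => (x (X b) : ℂ) := by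
      funext x
      rw [EuclideanSpace.inner_single_right]
      simp
    have := symbolPairing_inner_mul hN (SchwartzMap.smulLeftCLM ℂ
      (fun x : Space d => ∏ a ∈ A, (x (X a) : ℂ)) (schwartzDatum pbar lam β))
      (EuclideanSpace.single (X b) 1)
    rw [hc, SchwartzMap.smulLeftCLM_smulLeftCLM_apply
      (temperate_ofReal (temperate_coord (X b))) (temperate_coord_prod X A)] at this
    simp only [Finset.prod_insert hb]
    exact this.symm

/-- The `m`-th derivative of `β ↦ ⟨N, e^{-βV}⟩`, that is the pairing of `N` with
`(-V)^m e^{-βV}`. -/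
noncomputable def pairingDeriv (pbar : ℕ) (lam : (p : ℕ) → (Fin p → Fin d) → ℝ) (N : Space d → ℂ)
    (m : ℕ) (β : ℝ) : ℂ :=
  symbolPairing N (SchwartzMap.smulLeftCLM ℂ
    (fun x : Space d => (-(potential pbar lam x : ℂ)) ^ m) (schwartzDatum pbar lam β))

theorem hasDerivAt_pairingDeriv (hp : 2 ≤ pbar)
    (hlam : ∀ φ : Space d, φ ≠ 0 → 0 < tensorForm (lam pbar) φ) (N : Space d → ℂ) (m : ℕ) {β : ℝ}
    (hβ : 0 < β) :
    HasDerivAt (pairingDeriv pbar lam N m) (pairingDeriv pbar lam N (m + 1) β) β := by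
  have h := hasDerivAt_apply_schwartzDatum hp hlam ((symbolPairing N).comp
    (SchwartzMap.smulLeftCLM ℂ (fun x : Space d => (-(potential pbar lam x : ℂ)) ^ m))) hβ
  simp only [ContinuousLinearMap.comp_apply] at h
  rw [SchwartzMap.smulLeftCLM_smulLeftCLM_apply (temperate_neg_potential_pow pbar lam m)
    (by simpa using temperate_neg_potential_pow pbar lam 1)] at h
  exact h

theorem tendsto_pairingDeriv (hp : 2 ≤ pbar)
    (hlam : ∀ φ : Space d, φ ≠ 0 → 0 < tensorForm (lam pbar) φ) {N : Space d → ℂ}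
    (hN : N.HasTemperateGrowth) (hN0 : IsSymbolAtZero N) (m : ℕ) :
    Tendsto (pairingDeriv pbar lam N m) (𝓝[>] 0) (𝓝 ((-1) ^ m *
      ∑ p : Fin m → Fin (pbar + 1), ∑ X : Leg (fun j => (p j : ℕ)) → Fin d,
        (∏ j : Fin m, ((lam (p j) (fun l => X ⟨j, l⟩) : ℝ) : ℂ)) *
          zeroDeriv X Finset.univ N)) := by
  have hlim : Tendsto (fun β => (-1 : ℂ) ^ m *
      ∑ p : Fin m → Fin (pbar + 1), ∑ X : Leg (fun j => (p j : ℕ)) → Fin d,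
        (∏ j : Fin m, ((lam (p j) (fun l => X ⟨j, l⟩) : ℝ) : ℂ)) *
          symbolPairing N (SchwartzMap.smulLeftCLM ℂ
            (fun x : Space d => ∏ a, (x (X a) : ℂ)) (schwartzDatum pbar lam β))) (𝓝[>] 0) _ :=
    (tendsto_finsetSum _ fun p _ => tendsto_finsetSum _ fun X _ =>
      (tendsto_symbolPairing_monomial hp hlam X Finset.univ hN hN0).const_mul _).const_mul _
  refine hlim.congr fun β => ?_
  unfold pairingDeriv
  have hpt : SchwartzMap.smulLeftCLM ℂ (fun x : Space d => (-(potential pbar lam x : ℂ)) ^ m)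
      (schwartzDatum pbar lam β) = (-1 : ℂ) ^ m •
      ∑ p : Fin m → Fin (pbar + 1), ∑ X : Leg (fun j => (p j : ℕ)) → Fin d,
        (∏ j : Fin m, ((lam (p j) (fun l => X ⟨j, l⟩) : ℝ) : ℂ)) •
          SchwartzMap.smulLeftCLM ℂ
            (fun x : Space d => ∏ a, (x (X a) : ℂ)) (schwartzDatum pbar lam β) := by
    ext x
    rw [SchwartzMap.smulLeftCLM_apply_apply (temperate_neg_potential_pow pbar lam m)]
    simp only [smul_apply, sum_apply,
      SchwartzMap.smulLeftCLM_apply_apply (temperate_coord_prod _ Finset.univ)]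
    rw [neg_pow, ← Complex.ofReal_pow, potential_pow]
    push_cast
    simp only [smul_eq_mul, mul_assoc, Finset.sum_mul]
  rw [hpt]
  simp only [map_smul, map_sum, smul_eq_mul]

/-- The moments of `ν_t` translated by `φ`: the exponent vanishes at zero frequency, and the
recursion for the derivatives is the one for sums over partial partitions. -/
theorem zeroDeriv_exp_convExponent {Ψ : (Fin d → ℂ) → ℂ} (hΨ : IsAdmissibleSymbol Ψ) (t : ℝ)
    (φ : Space d) {L : Type} [DecidableEq L] (X : L → Fin d) (A : Finset L) :
    zeroDeriv X A (fun ξ => Complex.exp (convExponent Ψ t φ ξ)) =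
      partitionSum (blockWeight Ψ t X) (fun a => ((φ (X a) : ℝ) : ℂ)) A := by
  refine eq_partitionSum_of_recursion _ _
    (T := fun A => zeroDeriv X A (fun ξ => Complex.exp (convExponent Ψ t φ ξ))) ?_
    (fun A b hb => zeroDeriv_insert_exp_convExponent hΨ t φ X hb) A
  have h0 : axisSymbol Ψ 0 = 0 := by
    rw [axisSymbol_eq_comp, Function.comp_apply, map_zero, hΨ.map_zero]
  rw [zeroDeriv_empty, convExponent, h0]
  simp [translationExponent]

/-- The expansion of `(ν_t * f_β)(φ)` in powers of `β`, with sums over Feynman graphs as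
coefficients. -/
theorem isAsymptoticSeries_symbolPairing {Ψ : (Fin d → ℂ) → ℂ} (hΨ : IsAdmissibleSymbol Ψ)
    (hp : 2 ≤ pbar) (hlam : ∀ φ : Space d, φ ≠ 0 → 0 < tensorForm (lam pbar) φ) {t : ℝ}
    (ht : 0 ≤ t) (φ : Space d) :
    IsAsymptoticSeries
      (fun β => symbolPairing (fun ξ => Complex.exp (convExponent Ψ t φ ξ))
        (schwartzDatum pbar lam β))
      (fun m => (-1 : ℂ) ^ m / (m.factorial : ℂ) *
        ∑ G : FeynmanGraph pbar lam m, G.value Ψ t φ) := by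
  intro N
  have h := isAsymptoticSeries_of_hasDerivAt N _ _
    (fun m β hβ => hasDerivAt_pairingDeriv hp hlam
      (fun ξ => Complex.exp (convExponent Ψ t φ ξ)) m hβ)
    (fun m => tendsto_pairingDeriv hp hlam (temperate_exp_convExponent hΨ ht φ)
      (hΨ.isSymbolAtZero_convExponent t φ).exp m)
  refine h.congr fun β => ?_
  have h0 : pairingDeriv pbar lam (fun ξ => Complex.exp (convExponent Ψ t φ ξ)) 0 β =
      symbolPairing (fun ξ => Complex.exp (convExponent Ψ t φ ξ)) (schwartzDatum pbar lam β) := by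
    simp [pairingDeriv]
  rw [h0]
  congr 3
  refine Finset.sum_congr rfl fun m _ => ?_
  simp only [zeroDeriv_exp_convExponent hΨ, sum_value_eq, div_mul_eq_mul_div]

end Expansion

end FeynmanExpansion

theorem theorem2p11 (d : ℕ) (Ψ : (Fin d → ℂ) → ℂ)
    (hΨ : FeynmanExpansion.IsAdmissibleSymbol Ψ)
    (pbar : ℕ) (hpos : 0 < pbar) (heven : Even pbar)
    (lam : (p : ℕ) → (Fin p → Fin d) → ℝ)
    (hlam : ∀ φ : FeynmanExpansion.Space d, φ ≠ 0 →
      0 < FeynmanExpansion.tensorForm (lam pbar) φ) :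
    (∀ β : ℝ, 0 < β → ∀ u : ℝ → FeynmanExpansion.Space d → ℂ,
      FeynmanExpansion.IsCauchySolution Ψ (FeynmanExpansion.initialDatum pbar lam β) u ↔
        ∀ t : ℝ, 0 ≤ t → ∀ φ : FeynmanExpansion.Space d,
          u t φ = FeynmanExpansion.nuConv Ψ t (FeynmanExpansion.initialDatum pbar lam β) φ) ∧
    (∀ Φ : ℝ → ℝ → FeynmanExpansion.Space d → ℂ,
      (∀ β : ℝ, 0 < β → FeynmanExpansion.IsCauchySolution Ψ
        (FeynmanExpansion.initialDatum pbar lam β) (Φ β)) →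
      ∀ t : ℝ, 0 < t → ∀ φ : FeynmanExpansion.Space d,
        FeynmanExpansion.IsAsymptoticSeries (fun β => Φ β t φ)
          (fun m => (-1 : ℂ) ^ m / (m.factorial : ℂ) *
            ∑ G : FeynmanExpansion.FeynmanGraph pbar lam m, G.value Ψ t φ)) := by
  have hp : 2 ≤ pbar := by
    obtain ⟨k, rfl⟩ := heven
    omega
  have hcoe : ∀ β : ℝ, 0 < β → FeynmanExpansion.initialDatum pbar lam β =
      FeynmanExpansion.schwartzDatum pbar lam β := fun β hβ =>
    funext fun x => (FeynmanExpansion.schwartzDatum_apply hp hlam hβ x).symm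
  refine ⟨fun β hβ u => ?_, fun Φ hΦ t ht φ N => ?_⟩
  · rw [hcoe β hβ]
    exact FeynmanExpansion.isCauchySolution_iff hΨ _ u
  · refine (FeynmanExpansion.isAsymptoticSeries_symbolPairing hΨ hp hlam ht.le φ N).congr' ?_
    filter_upwards [self_mem_nhdsWithin] with β hβ
    have hsol := hΦ β hβ
    rw [hcoe β hβ] at hsol
    rw [(FeynmanExpansion.isCauchySolution_iff hΨ _ _).1 hsol t ht.le φ,
      FeynmanExpansion.nuConv_eq_symbolPairing hΨ ht.le]
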